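/- Let $k$ be an algebraically closed field of characteristic $0$, $\Gamma$ a finite abelian group, $(a_{ij})_{1\le i,j\le\theta}$ a finite Cartan matrix (a generalized Cartan matrix of finite type, not necessarily indecomposable), $g_1,\dots,g_\theta\in\Gamma$ and $\chi_1,\dots,\chi_\theta\in\widehat\Gamma$ characters $\Gamma\to k^\times$ such that $$\chi_i(g_i)\neq 1,\qquad \chi_j(g_i)\chi_i(g_j)=\chi_i(g_i)^{a_{ij}}\qquad\text{for all } i,j .$$ Write $i\sim j$ if $i$ and $j$ lie in the same connected component of the Dynkin diagram of $(a_{ij})$, and let $N_i$ be the order of $\chi_i(g_i)$. Assume that the order of $\chi_i(g_j)$ is odd for all $i,j$, and that $3\nmid N_i$ if $i$ belongs to a component of type $G_2$. Then $N_i=N_j$ if $i\sim j$; for a connected component $I$ let $N_I$ denote the common value of $N_i$, $i\in I$. Let $V$ be a Yetter–Drinfeld module over $\Gamma$ with a basis $x_1,\dots,x_\theta$ such that $x_i\in V_{g_i}^{\chi_i}$, i.e. $h\cdot x_i=\chi_i(h)x_i$ for $h\in\Gamma$ and $\delta(x_i)=g_i\otimes x_i$. Let $A$ be a pointed Hopf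 algebra over $k$ (not necessarily finite-dimensional) with $G(A)\simeq\Gamma$; identify $G(A)$ with $\Gamma$. Let $A_0\subseteq A_1\subseteq\cdots$ be its coradical filtration, $\operatorname{gr}A=\bigoplus_{n\ge0}A_n/A_{n-1}$ with graded projection $\pi:\operatorname{gr}A\to A_0=k\Gamma$, and let $R=\{x\in\operatorname{gr}A:(\mathrm{id}\otimes\pi)\Delta(x)=x\otimes1\}$ be the diagram of $A$, a braided Hopf algebra in the category ${}_\Gamma^\Gamma\mathcal{YD}$ of Yetter–Drinfeld modules over $\Gamma$ with the adjoint action of $\Gamma$, the coaction $(\pi\otimes\mathrm{id})\Delta$ and the comultiplication $\Delta_R(r)=r_{(1)}\pi(\mathcal S(r_{(2)}))\otimes r_{(3)}$. Assume given an isomorphism $\varphi:V\to P(R)$ in ${}_\Gamma^\Gamma\mathcal{YD}$, where $P(R)$ is the space of primitive elements of $R$. Let $a_1,\dots,a_\theta\in A$ satisfy $$\Delta(a_i)=a_i\otimes1+g_i\otimes a_i,\qquad ha_ih^{-1}=\chi_i(h)a_i\quad(h\in\Gamma),$$ and suppose that the class of $a_i$ in $A_1/A_0$ is $\varphi(x_i)$.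 Then: (a) There are scalars $\lambda_{ij}\in k$, for $1\le i<j\le\theta$ with $i\not\sim j$, such that $\lambda_{ij}=0$ unless $g_ig_j\ne1$ and $\chi_i\chi_j=1$ (that is, $(\lambda_{ij})$ is a linking datum), and $$a_ia_j-\chi_j(g_i)a_ja_i=\lambda_{ij}(1-g_ig_j)\qquad\text{for all } i<j,\ i\not\sim j .$$ (b) Let $I$ be a connected component of the Dynkin diagram. Assume that $N_I\ne3$; that $N_I\ne5$ if $I$ is of type $B_n$ or $C_n$ ($n\ge2$) or $F_4$; and that $N_I\ne7$ if $I$ is of type $G_2$. Then the quantum Serre relations $$(\operatorname{ad}a_i)^{1-a_{ij}}(a_j)=0\qquad\text{for all } i\ne j\in I$$ hold, where $\operatorname{ad}x(y)=x_{(1)}\,y\,\mathcal S(x_{(2)})$ is the adjoint representation of $A$. -/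

import Mathlib

open scoped TensorProduct

noncomputable section

namespace PointedHopf

/-! ## The coradical filtration of a coalgebra -/

section Coradical

variable (k : Type*) {C : Type*} [Field k] [AddCommGroup C] [Module k C] [Coalgebra k C]

/-- A subcoalgebra: a subspace `D` with `Δ(D) ⊆ D ⊗ D`. -/
def IsSubcoalgebra (D : Submodule k C) : Prop :=
  ∀ x ∈ D, Coalgebra.comul (R := k) x ∈ LinearMap.range (TensorProduct.map D.subtype D.subtype)

/-- A simple subcoalgebra: nonzero, with no subcoalgebras other than `0` and itself. -/
def IsSimpleSubcoalgebra (D : Submodule k C) : Prop :=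
  IsSubcoalgebra k D ∧ D ≠ ⊥ ∧ ∀ E : Submodule k C, IsSubcoalgebra k E → E ≤ D → E = ⊥ ∨ E = D

variable (C) in
/-- The coradical `C₀` (the largest cosemisimple subcoalgebra): the sum of all simple
subcoalgebras. -/
def coradical : Submodule k C := sSup {D | IsSimpleSubcoalgebra k D}

/-- The wedge `X ∧ Y = Δ⁻¹(X ⊗ C + C ⊗ Y)`. -/
def wedge (X Y : Submodule k C) : Submodule k C :=
  (LinearMap.range (X.subtype.rTensor C) ⊔ LinearMap.range (Y.subtype.lTensor C)).comap
    (Coalgebra.comul (R := k))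

variable (C) in
/-- The coradical filtration `C₀ ⊆ C₁ ⊆ …`, with `Cₙ₊₁ = Δ⁻¹(C₀ ⊗ C + C ⊗ Cₙ)`. -/
def coradicalFiltration : ℕ → Submodule k C
  | 0 => coradical k C
  | n + 1 => wedge k (coradical k C) (coradicalFiltration n)

variable (C) in
/-- The coradical filtration shifted by one: `prevFiltration n = Cₙ₋₁`, where `C₋₁ = 0`. -/
def prevFiltration : ℕ → Submodule k C
  | 0 => ⊥
  | n + 1 => coradicalFiltration k C n

variable (C) in
/-- The component `gr C(n) = Cₙ / Cₙ₋₁` of the associated graded coalgebra. -/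
abbrev GrPiece (n : ℕ) : Type _ :=
  coradicalFiltration k C n ⧸ (prevFiltration k C n).comap (coradicalFiltration k C n).subtype

variable (C) in
/-- The graded space `gr C = ⨁ₙ Cₙ / Cₙ₋₁`. -/
abbrev Gr : Type _ := DirectSum ℕ (GrPiece k C)

variable (C) in
/-- The class in `gr C(n)` of an element of `Cₙ`, as an element of `gr C`. -/
def grMk (n : ℕ) : coradicalFiltration k C n →ₗ[k] Gr k C :=
  DirectSum.lof k ℕ (GrPiece k C) n ∘ₗ Submodule.mkQ _

/-! The following facts are what is needed to see that `Δ` induces a map on `gr C`. -/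

theorem mem_wedge_iff (X Y : Submodule k C) (x : C) :
    x ∈ wedge k X Y ↔ TensorProduct.map X.mkQ Y.mkQ (Coalgebra.comul (R := k) x) = 0 := by
  have h := TensorProduct.map_ker (LinearMap.exact_subtype_mkQ X) X.mkQ_surjective
    (LinearMap.exact_subtype_mkQ Y) Y.mkQ_surjective
  rw [wedge, Submodule.mem_comap, sup_comm, ← h, LinearMap.mem_ker]

theorem isSubcoalgebra_coradical : IsSubcoalgebra k (coradical k C) := by
  have key : coradical k C ≤ (LinearMap.range (TensorProduct.map (coradical k C).subtype
      (coradical k C).subtype)).comap (Coalgebra.comul (R := k)) := by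
    refine sSup_le fun D hD x hx => ?_
    have hle : D ≤ coradical k C := le_sSup hD
    obtain ⟨z, hz⟩ := hD.1 x hx
    refine ⟨TensorProduct.map (Submodule.inclusion hle) (Submodule.inclusion hle) z, ?_⟩
    rw [← hz, ← LinearMap.comp_apply, ← TensorProduct.map_comp]
    rfl
  exact fun x hx => key hx

theorem map_comul_coradical {M N : Type*} [AddCommGroup M] [AddCommGroup N] [Module k M]
    [Module k N] (f : C →ₗ[k] M) (g : C →ₗ[k] N) {x : C} (hx : x ∈ coradical k C)
    (h : (∀ y ∈ coradical k C, f y = 0) ∨ (∀ y ∈ coradical k C, g y = 0)) :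
    TensorProduct.map f g (Coalgebra.comul (R := k) x) = 0 := by
  obtain ⟨z, hz⟩ := isSubcoalgebra_coradical k x hx
  rw [← hz, ← LinearMap.comp_apply, ← TensorProduct.map_comp]
  rcases h with h | h
  · have : f ∘ₗ (coradical k C).subtype = 0 := by ext y; exact h y y.2
    rw [this, TensorProduct.map_zero_left]; rfl
  · have : g ∘ₗ (coradical k C).subtype = 0 := by ext y; exact h y y.2
    rw [this, TensorProduct.map_zero_right]; rfl

theorem prevFiltration_succ (n : ℕ) :
    prevFiltration k C (n + 1) = wedge k (coradical k C) (prevFiltration k C n) := by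
  cases n with
  | succ n => rfl
  | zero =>
    apply le_antisymm
    · intro x hx
      rw [mem_wedge_iff]
      exact map_comul_coradical k _ _ hx (Or.inl fun y hy => by simpa using hy)
    · intro x hx
      rw [mem_wedge_iff] at hx
      let u : (C ⧸ (prevFiltration k C 0)) →ₗ[k] k :=
        (prevFiltration k C 0).liftQ (Coalgebra.counit (R := k)) (by simp [prevFiltration])
      have h2 : TensorProduct.map (coradical k C).mkQ (Coalgebra.counit (R := k) (A := C))
          (Coalgebra.comul (R := k) x) = 0 := by
        have : TensorProduct.map (coradical k C).mkQ (Coalgebra.counit (R := k) (A := C)) =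
            TensorProduct.map LinearMap.id u ∘ₗ
              TensorProduct.map (coradical k C).mkQ (prevFiltration k C 0).mkQ := by
          rw [← TensorProduct.map_comp]; rfl
        rw [this, LinearMap.comp_apply, hx, map_zero]
      have h3 : TensorProduct.map (coradical k C).mkQ (Coalgebra.counit (R := k) (A := C)) =
          (coradical k C).mkQ.rTensor k ∘ₗ (Coalgebra.counit (R := k) (A := C)).lTensor C := by
        ext; simp
      rw [h3, LinearMap.comp_apply, Coalgebra.lTensor_counit_comul, LinearMap.rTensor_tmul] at h2
      have h4 := congrArg (TensorProduct.rid k _) h2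
      have h5 : x ∈ coradical k C := by simpa using h4
      exact h5

/-- The injective map `C/Cₙ → C/C₀ ⊗ C/Cₙ₋₁` induced by `Δ`. -/
def wedgeMap (n : ℕ) : (C ⧸ prevFiltration k C (n + 1)) →ₗ[k]
    (C ⧸ coradical k C) ⊗[k] (C ⧸ prevFiltration k C n) :=
  (prevFiltration k C (n + 1)).liftQ
    (TensorProduct.map (coradical k C).mkQ (prevFiltration k C n).mkQ ∘ₗ Coalgebra.comul)
    (fun x hx => by
      rw [prevFiltration_succ] at hx
      exact (mem_wedge_iff k _ _ x).1 hx)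

theorem wedgeMap_injective (n : ℕ) : Function.Injective (wedgeMap k (C := C) n) := by
  rw [← LinearMap.ker_eq_bot, LinearMap.ker_eq_bot']
  intro y hy
  obtain ⟨x, rfl⟩ := Submodule.mkQ_surjective _ y
  rw [Submodule.mkQ_apply, Submodule.Quotient.mk_eq_zero, prevFiltration_succ, mem_wedge_iff]
  exact hy

theorem map_id_mkQ_comul (q : ℕ) {x : C} (hx : x ∈ prevFiltration k C q) :
    TensorProduct.map LinearMap.id (prevFiltration k C q).mkQ
      (Coalgebra.comul (R := k) x) = 0 := by
  cases q with
  | zero =>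
    have : x = 0 := by simpa [prevFiltration] using hx
    simp [this]
  | succ q =>
    apply Module.Flat.lTensor_preserves_injective_linearMap (M := C) _ (wedgeMap_injective k q)
    rw [map_zero]
    rw [prevFiltration_succ, mem_wedge_iff] at hx
    let G : (C ⧸ coradical k C) →ₗ[k] C ⊗[k] (C ⧸ coradical k C) :=
      (coradical k C).liftQ
        (TensorProduct.map LinearMap.id (coradical k C).mkQ ∘ₗ Coalgebra.comul)
        (fun y hy => map_comul_coradical k _ _ hy (Or.inr fun z hz => by simpa using hz))
    have h1 : (wedgeMap k q).lTensor C ∘ₗ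
        TensorProduct.map LinearMap.id (prevFiltration k C (q + 1)).mkQ =
        (TensorProduct.map LinearMap.id
          (TensorProduct.map (coradical k C).mkQ (prevFiltration k C q).mkQ)) ∘ₗ
          (Coalgebra.comul (R := k) (A := C)).lTensor C := by
      ext a b; rfl
    have h2 : (TensorProduct.map LinearMap.id
          (TensorProduct.map (coradical k C).mkQ (prevFiltration k C q).mkQ)) ∘ₗ
          (TensorProduct.assoc k C C C).toLinearMap =
        (TensorProduct.assoc k _ _ _).toLinearMap ∘ₗ
          (TensorProduct.map (TensorProduct.map (LinearMap.id (M := C)) (coradical k C).mkQ)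
            (prevFiltration k C q).mkQ) := by
      ext a b c; rfl
    have h3 : (TensorProduct.map (TensorProduct.map (LinearMap.id (M := C)) (coradical k C).mkQ)
            (prevFiltration k C q).mkQ) ∘ₗ (Coalgebra.comul (R := k) (A := C)).rTensor C =
        TensorProduct.map G LinearMap.id ∘ₗ
          TensorProduct.map (coradical k C).mkQ (prevFiltration k C q).mkQ := by
      ext a b; rfl
    have e1 := LinearMap.congr_fun h1 (Coalgebra.comul (R := k) x)
    have e2 := LinearMap.congr_fun h2
      ((Coalgebra.comul (R := k) (A := C)).rTensor C (Coalgebra.comul (R := k) x))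
    have e3 := LinearMap.congr_fun h3 (Coalgebra.comul (R := k) x)
    simp only [LinearMap.comp_apply, LinearEquiv.coe_coe] at e1 e2 e3
    rw [e1, ← Coalgebra.coassoc_apply, e2, e3, hx, map_zero, map_zero]

theorem map_mkQ_mkQ_comul (p q : ℕ) {x : C} (hx : x ∈ prevFiltration k C (p + q)) :
    TensorProduct.map (prevFiltration k C p).mkQ (prevFiltration k C q).mkQ
      (Coalgebra.comul (R := k) x) = 0 := by
  induction p generalizing x with
  | zero =>
    rw [Nat.zero_add] at hx
    have h : TensorProduct.map (prevFiltration k C 0).mkQ (prevFiltration k C q).mkQ =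
        (prevFiltration k C 0).mkQ.rTensor _ ∘ₗ
          TensorProduct.map LinearMap.id (prevFiltration k C q).mkQ := by
      ext a b; rfl
    rw [h, LinearMap.comp_apply, map_id_mkQ_comul k q hx, map_zero]
  | succ p ih =>
    apply Module.Flat.rTensor_preserves_injective_linearMap
      (M := C ⧸ prevFiltration k C q) _ (wedgeMap_injective k p)
    rw [map_zero]
    rw [Nat.add_right_comm, prevFiltration_succ, mem_wedge_iff] at hx
    let G : (C ⧸ prevFiltration k C (p + q)) →ₗ[k]
        (C ⧸ prevFiltration k C p) ⊗[k] (C ⧸ prevFiltration k C q) :=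
      (prevFiltration k C (p + q)).liftQ
        (TensorProduct.map (prevFiltration k C p).mkQ (prevFiltration k C q).mkQ ∘ₗ
          Coalgebra.comul) (fun y hy => ih hy)
    have h1 : (wedgeMap k p).rTensor (C ⧸ prevFiltration k C q) ∘ₗ
        TensorProduct.map (prevFiltration k C (p + 1)).mkQ (prevFiltration k C q).mkQ =
        (TensorProduct.map
          (TensorProduct.map (coradical k C).mkQ (prevFiltration k C p).mkQ)
            (prevFiltration k C q).mkQ) ∘ₗ
          (Coalgebra.comul (R := k) (A := C)).rTensor C := by
      ext a b; rfl
    have h2 : (TensorProduct.assoc k _ _ _).toLinearMap ∘ₗ (TensorProduct.map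
          (TensorProduct.map (coradical k C).mkQ (prevFiltration k C p).mkQ)
            (prevFiltration k C q).mkQ) =
        (TensorProduct.map (coradical k C).mkQ (TensorProduct.map (prevFiltration k C p).mkQ
            (prevFiltration k C q).mkQ)) ∘ₗ (TensorProduct.assoc k C C C).toLinearMap := by
      ext a b c; rfl
    have h3 : (TensorProduct.map (coradical k C).mkQ (TensorProduct.map (prevFiltration k C p).mkQ
            (prevFiltration k C q).mkQ)) ∘ₗ (Coalgebra.comul (R := k) (A := C)).lTensor C =
        TensorProduct.map LinearMap.id G ∘ₗ
          TensorProduct.map (coradical k C).mkQ (prevFiltration k C (p + q)).mkQ := by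
      ext a b; rfl
    have e1 := LinearMap.congr_fun h1 (Coalgebra.comul (R := k) x)
    have e2 := LinearMap.congr_fun h2
      ((Coalgebra.comul (R := k) (A := C)).rTensor C (Coalgebra.comul (R := k) x))
    have e3 := LinearMap.congr_fun h3 (Coalgebra.comul (R := k) x)
    simp only [LinearMap.comp_apply, LinearEquiv.coe_coe] at e1 e2 e3
    rw [e1]
    apply (TensorProduct.assoc k _ _ _).injective
    rw [e2, Coalgebra.coassoc_apply, e3, hx, map_zero, map_zero]

theorem prevFiltration_le (n : ℕ) : prevFiltration k C n ≤ prevFiltration k C (n + 1) := by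
  intro x hx
  rw [prevFiltration_succ, mem_wedge_iff]
  have h : TensorProduct.map (coradical k C).mkQ (prevFiltration k C n).mkQ =
      (coradical k C).mkQ.rTensor _ ∘ₗ
        TensorProduct.map LinearMap.id (prevFiltration k C n).mkQ := by
    ext a b; rfl
  rw [h, LinearMap.comp_apply, map_id_mkQ_comul k n hx, map_zero]

/-- The inclusion `Cₙ/Cₙ₋₁ ⊆ C/Cₙ₋₁`. -/
def grEmb (n : ℕ) : GrPiece k C n →ₗ[k] C ⧸ prevFiltration k C n :=
  Submodule.mapQ _ _ (coradicalFiltration k C n).subtype le_rfl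

theorem grEmb_injective (n : ℕ) : Function.Injective (grEmb k (C := C) n) := by
  rw [← LinearMap.ker_eq_bot, LinearMap.ker_eq_bot']
  intro y hy
  obtain ⟨x, rfl⟩ := Submodule.mkQ_surjective _ y
  simpa [grEmb] using hy

/-- The projection `C/Cₙ₋₁ → C/Cₙ`. -/
def prevProj (n : ℕ) : (C ⧸ prevFiltration k C n) →ₗ[k] C ⧸ prevFiltration k C (n + 1) :=
  Submodule.factor (prevFiltration_le k n)

theorem exact_grEmb (n : ℕ) : Function.Exact (grEmb k (C := C) n) (prevProj k n) := by
  intro y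
  obtain ⟨x, rfl⟩ := Submodule.mkQ_surjective _ y
  have h1 : prevProj k n ((prevFiltration k C n).mkQ x) =
      (prevFiltration k C (n + 1)).mkQ x := rfl
  rw [h1, Submodule.mkQ_apply, Submodule.Quotient.mk_eq_zero]
  constructor
  · intro hx
    exact ⟨Submodule.mkQ _ ⟨x, hx⟩, rfl⟩
  · rintro ⟨z, hz⟩
    obtain ⟨w, rfl⟩ := Submodule.mkQ_surjective _ z
    have h2 : (w : C) - x ∈ prevFiltration k C n := by
      rw [← Submodule.Quotient.eq]; exact hz
    have h3 := (prevFiltration k C (n + 1)).sub_mem w.2 (prevFiltration_le k n h2)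
    simpa using h3

theorem comul_mem_range_grEmb {n p q : ℕ} (h : p + q = n) (x : coradicalFiltration k C n) :
    TensorProduct.map (prevFiltration k C p).mkQ (prevFiltration k C q).mkQ
      (Coalgebra.comul (R := k) (x : C)) ∈
      LinearMap.range (TensorProduct.map (grEmb k (C := C) p) (grEmb k (C := C) q)) := by
  set y := TensorProduct.map (prevFiltration k C p).mkQ (prevFiltration k C q).mkQ
      (Coalgebra.comul (R := k) (x : C)) with hy
  have hx1 : (x : C) ∈ prevFiltration k C (p + 1 + q) := by
    rw [Nat.add_right_comm, h]; exact x.2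
  have hx2 : (x : C) ∈ prevFiltration k C (p + (q + 1)) := by
    rw [← Nat.add_assoc, h]; exact x.2
  have hy1 : (prevProj k p).rTensor (C ⧸ prevFiltration k C q) y = 0 := by
    rw [hy, ← map_mkQ_mkQ_comul k (p + 1) q hx1, ← LinearMap.comp_apply,
      LinearMap.rTensor_comp_map]
    rfl
  have hy2 : (prevProj k q).lTensor (C ⧸ prevFiltration k C p) y = 0 := by
    rw [hy, ← map_mkQ_mkQ_comul k p (q + 1) hx2, ← LinearMap.comp_apply,
      LinearMap.lTensor_comp_map]
    rfl
  obtain ⟨z, hz⟩ := (Module.Flat.rTensor_exact (C ⧸ prevFiltration k C q) (exact_grEmb k p) y).1 hy1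
  have hz2 : (prevProj k q).lTensor (GrPiece k C p) z = 0 := by
    apply Module.Flat.rTensor_preserves_injective_linearMap
      (M := C ⧸ prevFiltration k C (q + 1)) _ (grEmb_injective k p)
    rw [map_zero, ← hy2, ← hz, ← LinearMap.comp_apply, ← LinearMap.comp_apply,
      LinearMap.rTensor_comp_lTensor, LinearMap.lTensor_comp_rTensor]
  obtain ⟨w, hw⟩ := (Module.Flat.lTensor_exact (GrPiece k C p) (exact_grEmb k q) z).1 hz2
  refine ⟨w, ?_⟩
  rw [← hz, ← hw, ← LinearMap.comp_apply, LinearMap.rTensor_comp_lTensor]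

theorem map_grEmb_injective (p q : ℕ) : Function.Injective
    (TensorProduct.map (grEmb k (C := C) p) (grEmb k (C := C) q)) := by
  rw [← LinearMap.rTensor_comp_lTensor]
  exact (Module.Flat.rTensor_preserves_injective_linearMap _ (grEmb_injective k p)).comp
    (Module.Flat.lTensor_preserves_injective_linearMap _ (grEmb_injective k q))

/-- The component `gr C(n) → gr C(p) ⊗ gr C(q)`, `p + q = n`, of the comultiplication of `gr C`:
it is induced by `Δ`, that is, it sends the class of `x ∈ Cₙ` to the unique element of
`gr C(p) ⊗ gr C(q)` whose image in `C/Cₚ₋₁ ⊗ C/C_{q-1}` is the image of `Δ(x)`. -/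
def grComulComponent {n p q : ℕ} (h : p + q = n) :
    GrPiece k C n →ₗ[k] GrPiece k C p ⊗[k] GrPiece k C q :=
  Submodule.liftQ _
    ((LinearEquiv.ofInjective _ (map_grEmb_injective k p q)).symm.toLinearMap ∘ₗ
      LinearMap.codRestrict _
        (TensorProduct.map (prevFiltration k C p).mkQ (prevFiltration k C q).mkQ ∘ₗ
          Coalgebra.comul ∘ₗ (coradicalFiltration k C n).subtype)
        (comul_mem_range_grEmb k h))
    (fun x hx => by
      have hx' : (x : C) ∈ prevFiltration k C (p + q) := by rw [h]; exact hx
      rw [LinearMap.mem_ker, LinearMap.comp_apply, LinearEquiv.coe_coe,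
        LinearEquiv.map_eq_zero_iff]
      exact Subtype.ext (map_mkQ_mkQ_comul k p q hx'))

theorem map_grEmb_grComulComponent {n p q : ℕ} (h : p + q = n) (x : coradicalFiltration k C n) :
    TensorProduct.map (grEmb k p) (grEmb k q) (grComulComponent k h (Submodule.Quotient.mk x)) =
      TensorProduct.map (prevFiltration k C p).mkQ (prevFiltration k C q).mkQ
        (Coalgebra.comul (R := k) (x : C)) :=
  congrArg Subtype.val ((LinearEquiv.ofInjective _ (map_grEmb_injective k p q)).apply_symm_apply
    ⟨_, comul_mem_range_grEmb k h x⟩)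

variable (C) in
/-- The comultiplication of `gr C`, the sum of its components. -/
def grComul : Gr k C →ₗ[k] Gr k C ⊗[k] Gr k C :=
  DirectSum.toModule k ℕ _ fun n => ∑ p : Fin (n + 1),
    TensorProduct.map (DirectSum.lof k ℕ (GrPiece k C) p) (DirectSum.lof k ℕ (GrPiece k C) (n - p))
      ∘ₗ grComulComponent k (Nat.add_sub_of_le (Nat.lt_succ_iff.1 p.2))

theorem coradicalFiltration_zero_le : coradicalFiltration k C 0 ≤ coradical k C := le_rfl

theorem prevFiltration_zero_le : (prevFiltration k C 0).comap (coradicalFiltration k C 0).subtype ≤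
    LinearMap.ker (Submodule.inclusion (coradicalFiltration_zero_le k (C := C))) := by
  intro x hx
  have h : (x : C) = 0 := hx
  exact LinearMap.mem_ker.2 (Subtype.ext h)

variable (C) in
/-- The graded projection `π : gr C → gr C(0) = C₀`. -/
def grProj : Gr k C →ₗ[k] coradical k C :=
  Submodule.liftQ _ (Submodule.inclusion (coradicalFiltration_zero_le k)) (prevFiltration_zero_le k)
    ∘ₗ DirectSum.component k ℕ (GrPiece k C) 0

theorem coradicalFiltration_map_mem (f : C →ₗ[k] C)
    (hf : (Coalgebra.comul (R := k)) ∘ₗ f = TensorProduct.map f f ∘ₗ Coalgebra.comul)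
    (h0 : ∀ x ∈ coradical k C, f x ∈ coradical k C) (n : ℕ) {x : C}
    (hx : x ∈ coradicalFiltration k C n) : f x ∈ coradicalFiltration k C n := by
  induction n generalizing x with
  | zero => exact h0 x hx
  | succ n ih =>
    rw [coradicalFiltration, mem_wedge_iff] at hx ⊢
    have h1 := LinearMap.congr_fun hf x
    simp only [LinearMap.comp_apply] at h1
    have h2 : TensorProduct.map (coradical k C).mkQ (coradicalFiltration k C n).mkQ ∘ₗ
        TensorProduct.map f f =
        TensorProduct.map (Submodule.mapQ _ _ f h0) (Submodule.mapQ _ _ f (fun y hy => ih hy)) ∘ₗ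
        TensorProduct.map (coradical k C).mkQ (coradicalFiltration k C n).mkQ := by
      ext a b; rfl
    rw [h1, ← LinearMap.comp_apply, h2, LinearMap.comp_apply, hx, map_zero]

/-- The graded endomorphism of `gr C` induced by a filtered endomorphism of `C`. -/
def grMap (f : C →ₗ[k] C)
    (hf : ∀ (n : ℕ), ∀ x ∈ coradicalFiltration k C n, f x ∈ coradicalFiltration k C n) :
    Gr k C →ₗ[k] Gr k C :=
  DirectSum.lmap fun n => Submodule.mapQ _ _ (f.restrict (hf n)) (fun x hx => by
    cases n with
    | zero =>
      have : (x : C) = 0 := hx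
      have h2 : f (x : C) = 0 := by rw [this, map_zero]
      exact h2
    | succ n => exact hf n x hx)

end Coradical

/-! ## The diagram of a pointed Hopf algebra -/

section Diagram

variable (k : Type*) (A : Type*) [Field k] [Ring A] [HopfAlgebra k A]

/-- A Hopf algebra is pointed if its coradical is spanned by the group-like elements. -/
class IsPointed : Prop where
  coradical_eq : coradical k A = Submodule.span k {x : A | IsGroupLikeElem k x}

variable {A} [IsPointed k A]

theorem groupLike_mem_coradical {g : A} (hg : IsGroupLikeElem k g) : g ∈ coradical k A := by
  rw [IsPointed.coradical_eq]
  exact Submodule.subset_span hg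

theorem mul_mem_coradical {c x : A} (hc : c ∈ coradical k A) (hx : x ∈ coradical k A) :
    c * x ∈ coradical k A := by
  rw [IsPointed.coradical_eq] at *
  have := Submodule.mul_mem_mul hc hx
  rw [Submodule.span_mul_span] at this
  refine Submodule.span_mono ?_ this
  rintro _ ⟨a, ha, b, hb, rfl⟩
  exact IsGroupLikeElem.mul ha hb

theorem antipode_mem_coradical {c : A} (hc : c ∈ coradical k A) :
    HopfAlgebra.antipode k c ∈ coradical k A := by
  rw [IsPointed.coradical_eq] at *
  induction hc using Submodule.span_induction with
  | mem x hx => exact Submodule.subset_span (IsGroupLikeElem.antipode hx)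
  | zero => simp
  | add x y _ _ hx hy => rw [map_add]; exact Submodule.add_mem _ hx hy
  | smul a x _ hx => rw [map_smul]; exact Submodule.smul_mem _ a hx

theorem groupLike_mul_mem {g : A} (hg : IsGroupLikeElem k g) (n : ℕ) {x : A}
    (hx : x ∈ coradicalFiltration k A n) : g * x ∈ coradicalFiltration k A n := by
  refine coradicalFiltration_map_mem k (LinearMap.mulLeft k g) ?_
    (fun y hy => mul_mem_coradical k (groupLike_mem_coradical k hg) hy) n hx
  ext y
  simp only [LinearMap.comp_apply, LinearMap.mulLeft_apply, Bialgebra.comul_mul,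
    hg.comul_eq_tmul_self]
  induction Coalgebra.comul (R := k) y using TensorProduct.induction_on with
  | zero => simp
  | tmul a b => simp
  | add a b ha hb => rw [mul_add, ha, hb, map_add]

theorem mul_groupLike_mem {g : A} (hg : IsGroupLikeElem k g) (n : ℕ) {x : A}
    (hx : x ∈ coradicalFiltration k A n) : x * g ∈ coradicalFiltration k A n := by
  refine coradicalFiltration_map_mem k (LinearMap.mulRight k g) ?_
    (fun y hy => mul_mem_coradical k hy (groupLike_mem_coradical k hg)) n hx
  ext y
  simp only [LinearMap.comp_apply, LinearMap.mulRight_apply, Bialgebra.comul_mul,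
    hg.comul_eq_tmul_self]
  induction Coalgebra.comul (R := k) y using TensorProduct.induction_on with
  | zero => simp
  | tmul a b => simp
  | add a b ha hb => rw [add_mul, ha, hb, map_add]

theorem mul_coradical_mem {c : A} (hc : c ∈ coradical k A) (n : ℕ) {x : A}
    (hx : x ∈ coradicalFiltration k A n) : x * c ∈ coradicalFiltration k A n := by
  rw [IsPointed.coradical_eq] at hc
  induction hc using Submodule.span_induction with
  | mem g hg => exact mul_groupLike_mem k hg n hx
  | zero => simp
  | add c d _ _ hc hd => rw [mul_add]; exact Submodule.add_mem _ hc hd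
  | smul a c _ hc => rw [mul_smul_comm]; exact Submodule.smul_mem _ a hc

variable (A)

/-- The right multiplication of `gr A` by elements of `gr A(0) = A₀`. -/
def grMulRight : coradical k A →ₗ[k] Gr k A →ₗ[k] Gr k A where
  toFun c := grMap k (LinearMap.mulRight k (c : A)) fun n _ hx => mul_coradical_mem k c.2 n hx
  map_add' c d := by
    refine DirectSum.linearMap_ext k fun n => LinearMap.ext fun z => ?_
    obtain ⟨x, rfl⟩ := Submodule.mkQ_surjective _ z
    simp only [LinearMap.comp_apply, LinearMap.add_apply, grMap, DirectSum.lmap_lof,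
      Submodule.mkQ_apply, Submodule.mapQ_apply, ← map_add, ← Submodule.Quotient.mk_add]
    congr 2
    exact Subtype.ext (mul_add _ _ _)
  map_smul' r c := by
    refine DirectSum.linearMap_ext k fun n => LinearMap.ext fun z => ?_
    obtain ⟨x, rfl⟩ := Submodule.mkQ_surjective _ z
    simp only [LinearMap.comp_apply, LinearMap.smul_apply, grMap, DirectSum.lmap_lof,
      Submodule.mkQ_apply, Submodule.mapQ_apply, ← map_smul, ← Submodule.Quotient.mk_smul,
      RingHom.id_apply]
    congr 2
    exact Subtype.ext ((mul_smul_comm _ _ _).trans (smul_mul_assoc _ _ _).symm)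

variable {A} in
/-- The adjoint action of a group-like element on `gr A`, induced by `x ↦ h x S(h) = h x h⁻¹`. -/
def grAdjoint (h : GroupLike k A) : Gr k A →ₗ[k] Gr k A :=
  grMap k (LinearMap.mulLeft k (h : A) ∘ₗ LinearMap.mulRight k (HopfAlgebra.antipode k (h : A)))
    fun n _ hx => groupLike_mul_mem k h.2 n (mul_groupLike_mem k h.2.antipode n hx)

/-- The unit of `gr A(0) = A₀`. -/
def coradicalOne : coradical k A := ⟨1, groupLike_mem_coradical k .one⟩

/-- The unit of `gr A`. -/
def grOne : Gr k A := grMk k A 0 (coradicalOne k A)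

/-- The diagram `R = {x ∈ gr A : (id ⊗ π) Δ(x) = x ⊗ 1}` of a pointed Hopf algebra. -/
def diagram : Submodule k (Gr k A) :=
  LinearMap.eqLocus ((grProj k A).lTensor (Gr k A) ∘ₗ grComul k A)
    ((TensorProduct.mk k (Gr k A) (coradical k A)).flip (coradicalOne k A))

/-- The coaction `(π ⊗ id) Δ` of `A₀ = k G(A)` on `gr A`; it restricts to the coaction on the
diagram. -/
def grCoaction : Gr k A →ₗ[k] coradical k A ⊗[k] Gr k A :=
  (grProj k A).rTensor (Gr k A) ∘ₗ grComul k A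

/-- The linear map `gr A ⊗ gr A → gr A`, `x ⊗ y ↦ x · S(π(y))`. -/
def grMulAntipode : Gr k A ⊗[k] Gr k A →ₗ[k] Gr k A :=
  TensorProduct.lift ((grMulRight k A).flip.compl₂
    ((HopfAlgebra.antipode k (A := A)).restrict (fun _ hc => antipode_mem_coradical k hc) ∘ₗ
      grProj k A))

/-- The map `r ↦ r₍₁₎ π(S(r₍₂₎)) ⊗ r₍₃₎` on `gr A`; it restricts to the comultiplication `Δ_R` of
the diagram `R` as a braided Hopf algebra. -/
def braidedComul : Gr k A →ₗ[k] Gr k A ⊗[k] Gr k A :=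
  (grMulAntipode k A).rTensor (Gr k A) ∘ₗ (grComul k A).rTensor (Gr k A) ∘ₗ grComul k A

/-- The space `P(R) = {r ∈ R : Δ_R(r) = r ⊗ 1 + 1 ⊗ r}` of primitive elements of the diagram. -/
def diagramPrimitives : Submodule k (Gr k A) :=
  diagram k A ⊓ LinearMap.eqLocus (braidedComul k A)
    ((TensorProduct.mk k (Gr k A) (Gr k A)).flip (grOne k A) +
      TensorProduct.mk k (Gr k A) (Gr k A) (grOne k A))

end Diagram

/-! ## Skew-primitive elements and the adjoint representation -/

section Hopf

variable (k : Type*) {A : Type*} [Field k] [Ring A] [HopfAlgebra k A]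

/-- `x` is a `(g, h)`-skew primitive: `Δ(x) = x ⊗ h + g ⊗ x`. -/
def IsSkewPrimitive (g h x : A) : Prop :=
  Coalgebra.comul (R := k) x = x ⊗ₜ[k] h + g ⊗ₜ[k] x

/-- The adjoint representation `ad x (y) = x₍₁₎ y S(x₍₂₎)` of a Hopf algebra on itself. -/
def ad : A →ₗ[k] Module.End k A :=
  TensorProduct.lift ((LinearMap.mul k (Module.End k A)).compl₁₂ (LinearMap.mul k A)
    ((LinearMap.mul k A).flip ∘ₗ HopfAlgebra.antipode k)) ∘ₗ Coalgebra.comul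

end Hopf

/-! ## Yetter-Drinfeld modules over a group algebra -/

/-- A Yetter-Drinfeld module over `k[Γ]`: an action and a (left) coaction on `V` such that
`δ(h · v) = h v₍₋₁₎ h⁻¹ ⊗ h · v₍₀₎` for all `h ∈ Γ`. -/
structure YetterDrinfeld (k Γ V : Type*) [Field k] [Group Γ] [AddCommGroup V] [Module k V] where
  /-- the action of `Γ` -/
  action : Representation k Γ V
  /-- the coaction of `k[Γ]` -/
  coaction : V →ₗ[k] MonoidAlgebra k Γ ⊗[k] V
  counit_coaction : TensorProduct.lid k V ∘ₗ
    (Coalgebra.counit (R := k) (A := MonoidAlgebra k Γ)).rTensor V ∘ₗ coaction = LinearMap.id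
  coassoc : (TensorProduct.assoc k (MonoidAlgebra k Γ) (MonoidAlgebra k Γ) V).toLinearMap ∘ₗ
    (Coalgebra.comul (R := k) (A := MonoidAlgebra k Γ)).rTensor V ∘ₗ coaction =
      coaction.lTensor (MonoidAlgebra k Γ) ∘ₗ coaction
  compatible : ∀ h : Γ, coaction ∘ₗ action h =
    TensorProduct.map (LinearMap.mulLeft k (MonoidAlgebra.of k Γ h) ∘ₗ
      LinearMap.mulRight k (MonoidAlgebra.of k Γ h⁻¹)) (action h) ∘ₗ coaction

/-- Membership in `V_g^χ = {v : h · v = χ(h) v for all h ∈ Γ, and δ(v) = g ⊗ v}`. -/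
def YetterDrinfeld.IsHomogeneous {k Γ V : Type*} [Field k] [Group Γ] [AddCommGroup V] [Module k V]
    (Y : YetterDrinfeld k Γ V) (g : Γ) (χ : Γ →* kˣ) (v : V) : Prop :=
  (∀ h : Γ, Y.action h v = (χ h : k) • v) ∧ Y.coaction v = MonoidAlgebra.of k Γ g ⊗ₜ[k] v

/-- The identification `k[Γ] → k G(A) = A₀` given by a group isomorphism `Γ ≃ G(A)`. -/
def groupAlgebraToCoradical {k Γ A : Type*} [Field k] [Group Γ] [Ring A] [HopfAlgebra k A]
    [IsPointed k A] (e : Γ ≃* GroupLike k A) : MonoidAlgebra k Γ →ₗ[k] coradical k A :=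
  LinearMap.codRestrict _
    (MonoidAlgebra.lift k A Γ ((GroupLike.valMonoidHom k A).comp e.toMonoidHom)).toLinearMap
    (fun x => by
      induction x using MonoidAlgebra.induction_linear with
      | zero => simp
      | add f g hf hg => rw [map_add]; exact Submodule.add_mem _ hf hg
      | single g r =>
        simpa using Submodule.smul_mem _ r (groupLike_mem_coradical k (e g).2))

/-- A linear bijection `φ : V → P(R)` is an isomorphism of Yetter-Drinfeld modules over `Γ`
(`Γ` identified with `G(A)` by `e`) if it respects the actions and the coactions. Those of `P(R)`
are the restrictions of the adjoint action and of the coaction `(π ⊗ id) Δ` on `gr A`. -/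
def IsYetterDrinfeldIso {k Γ V A : Type*} [Field k] [Group Γ] [AddCommGroup V] [Module k V]
    [Ring A] [HopfAlgebra k A] [IsPointed k A] (e : Γ ≃* GroupLike k A)
    (Y : YetterDrinfeld k Γ V) (φ : V ≃ₗ[k] diagramPrimitives k A) : Prop :=
  (∀ (h : Γ) (v : V), (φ (Y.action h v) : Gr k A) = grAdjoint k (e h) (φ v)) ∧
  ∀ v : V, grCoaction k A (φ v) =
    TensorProduct.map (groupAlgebraToCoradical e)
      ((diagramPrimitives k A).subtype ∘ₗ φ.toLinearMap) (Y.coaction v)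

/-! ## Finite Cartan matrices and linking data -/

section Cartan

variable {ι : Type*}

/-- A finite Cartan matrix (a generalized Cartan matrix of finite type): `aᵢᵢ = 2`, the
off-diagonal entries are nonpositive with `aᵢⱼ = 0 → aⱼᵢ = 0`, and `D a` is symmetric and positive
definite for some diagonal matrix `D` with positive entries. -/
structure IsFiniteCartanMatrix [Fintype ι] [DecidableEq ι] (a : Matrix ι ι ℤ) : Prop where
  diag : ∀ i, a i i = 2
  nonpos : ∀ i j, i ≠ j → a i j ≤ 0
  zero : ∀ i j, a i j = 0 → a j i = 0
  posDef : ∃ d : ι → ℝ, (∀ i, 0 < d i) ∧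
    (Matrix.diagonal d * a.map (Int.cast : ℤ → ℝ)).PosDef

/-- The Dynkin diagram of `a`, without the multiplicities of its edges. -/
def dynkinGraph (a : Matrix ι ι ℤ) : SimpleGraph ι := SimpleGraph.fromRel fun i j => a i j ≠ 0

/-- A set `I` of vertices is of the type given by the matrix `c` if, for some numbering of `I`, the
submatrix of `a` indexed by `I` is `c`. -/
def IsOfType (a : Matrix ι ι ℤ) (I : Set ι) {n : ℕ} (c : Matrix (Fin n) (Fin n) ℤ) : Prop :=
  ∃ f : Fin n ≃ I, ∀ s t, a (f s) (f t) = c s t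

/-- `I` is of type `Bₙ` or `Cₙ` for some `n ≥ 2`, or of type `F₄`. -/
def IsOfTypeBCF (a : Matrix ι ι ℤ) (I : Set ι) : Prop :=
  (∃ n, 2 ≤ n ∧ (IsOfType a I (CartanMatrix.B n) ∨ IsOfType a I (CartanMatrix.C n))) ∨
    IsOfType a I CartanMatrix.F₄

variable {k Γ : Type*} [Field k] [CommGroup Γ]

/-- Vertices `i` and `j` are linkable: they lie in different connected components, `gᵢgⱼ ≠ 1`
and `χᵢχⱼ = 1`. -/
def Linkable (a : Matrix ι ι ℤ) (g : ι → Γ) (χ : ι → Γ →* kˣ) (i j : ι) : Prop :=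
  ¬ (dynkinGraph a).Reachable i j ∧ g i * g j ≠ 1 ∧ χ i * χ j = 1

/-- A linking datum: a family of scalars `λᵢⱼ`, for `i < j` in different connected components, that
vanishes unless `i` and `j` are linkable. Only the entries `l i j` for such pairs matter. -/
def IsLinkingDatum [LT ι] (a : Matrix ι ι ℤ) (g : ι → Γ) (χ : ι → Γ →* kˣ) (l : ι → ι → k) :
    Prop :=
  ∀ i j, i < j → ¬ (dynkinGraph a).Reachable i j → ¬ Linkable a g χ i j → l i j = 0

end Cartan

end PointedHopf

end

/-!
The proof has three ingredients.

*Skew-primitive elements.* Let `z` be skew primitive, `Δ(z) = z ⊗ 1 + γ ⊗ z`, and suppose that `Γ`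
acts on `z` by a character `ψ`. Then `z ∈ A₁`, and the class of `z` in `A₁ / A₀` is a primitive
element of the diagram, on which `Γ` acts by `ψ` and coacts by `γ`. As the space of primitive
elements is isomorphic to `V`, either `(γ, ψ) = (g_l, χ_l)` for some `l`, or the class is zero, and
then `z` lies in the group algebra `A₀`, hence `z = c (1 - γ)`; since `Γ` is abelian, this forces
`z = 0` unless `ψ = 1` (`IsSkewPrimitive.exists_eq_smul_of_degree`).

*Iterated commutators.* The element `(ad aᵢ)ⁿ(aⱼ)` has a comultiplication whose coefficients are
products of `q`-binomial coefficients and factors `1 - qᵢˡ χⱼ(gᵢ) χᵢ(gⱼ)` (`comul_adSeq`). By the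
Cartan condition the lower coefficients vanish for `n = 1 - aᵢⱼ`, so that this element is skew
primitive (`isSkewPrimitive_ad_pow`). This covers the commutators of the first assertion as well,
where `aᵢⱼ = 0`.

*Arithmetic of the braiding.* It remains to exclude that the degree `(gᵢⁿgⱼ, χᵢⁿχⱼ)`,
`n = 1 - aᵢⱼ`, is some `(g_l, χ_l)`, and, for `i ∼ j`, that the character is trivial. Either would
give `qᵢᵐ = 1` for an explicit `m` depending on entries of the Cartan matrix, and positive
definiteness leaves only `|m| ≤ 5` or `|m| = 7` (`not_degree_of_not_reachable`,
`not_degree_of_reachable`, `character_ne_one_of_reachable`). As the order of `qᵢ` is odd, it would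
be `3`, `5` or `7`. Order `3` is excluded. Apart from cases in type `G₂`, which lead to a
contradiction, order `5` needs a double edge and order `7` a triple edge; a component with such an
edge is of type `Bₙ`, `Cₙ`, `F₄` or `G₂` (`IsFiniteCartanMatrix.isOfTypeBCF`,
`IsFiniteCartanMatrix.isOfType_G₂`). For `i ∼ j` with `aᵢⱼ = 0` the triviality of the character
means `qᵢqⱼ = 1`, which is impossible since `qᵢ` and `qⱼ` are both among `u, u²` for some `u`
(`IsFiniteCartanMatrix.exists_eq_or_eq_sq`).
-/

noncomputable section

namespace PointedHopf

/-! ### Finite Cartan matrices: forbidden subdiagrams -/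

section Cartan

variable {ι : Type*} [Fintype ι] [DecidableEq ι] {a : Matrix ι ι ℤ}

/-- A Cartan matrix of finite type has no nonzero nonnegative vector `w` such that `a w ≤ 0` on the
support of `w`: otherwise the positive definite form `D a` would be nonpositive at `w`. The vector
lives on a family `f` of vertices; since the off-diagonal entries are nonpositive, it is enough to
bound each coordinate of `a w` by the sum over some `T` containing the diagonal term. -/
theorem IsFiniteCartanMatrix.not_subharmonic (ha : IsFiniteCartanMatrix a) {κ : Type*}
    (S : Finset κ) (f : κ → ι) (hf : Set.InjOn f S) (w : κ → ℤ)
    (hw : ∀ s ∈ S, 0 < w s) (hS : S.Nonempty)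
    (h : ∀ s ∈ S, ∃ T ⊆ S, s ∈ T ∧ ∑ t ∈ T, a (f s) (f t) * w t ≤ 0) : False := by
  classical
  obtain ⟨d, hd, hpos⟩ := ha.posDef
  have hrow : ∀ s ∈ S, ∑ t ∈ S, a (f s) (f t) * w t ≤ 0 := by
    intro s hs
    obtain ⟨T, hTS, hsT, hT⟩ := h s hs
    refine le_trans ?_ hT
    rw [← Finset.sum_sdiff hTS]
    have : ∑ t ∈ S \ T, a (f s) (f t) * w t ≤ 0 := by
      refine Finset.sum_nonpos fun t ht => ?_
      rw [Finset.mem_sdiff] at ht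
      refine mul_nonpos_of_nonpos_of_nonneg (ha.nonpos _ _ fun hst => ht.2 ?_) (hw t ht.1).le
      rwa [← hf hs ht.1 hst]
    linarith
  let x : ι → ℝ := ∑ s ∈ S, Pi.single (f s) (w s : ℝ)
  have hx : ∀ s ∈ S, x (f s) = w s := by
    intro s hs
    simp only [x, Finset.sum_apply]
    rw [Finset.sum_eq_single s]
    · simp
    · intro t ht hts
      exact Pi.single_eq_of_ne (fun e => hts (hf ht hs e.symm)) _
    · intro hs'; exact absurd hs hs'
  have hx0 : x ≠ 0 := by
    obtain ⟨s, hs⟩ := hS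
    intro h0
    have h1 := hx s hs
    rw [h0] at h1
    have h2 := hw s hs
    have h3 : (w s : ℝ) = 0 := h1.symm
    have h4 : w s = 0 := by exact_mod_cast h3
    omega
  have h1 := hpos.dotProduct_mulVec_pos hx0
  have hmv : ∀ i, (a.map (Int.cast : ℤ → ℝ)).mulVec x i = ∑ t ∈ S, (a i (f t) : ℝ) * w t := by
    intro i
    simp only [x, Matrix.mulVec_sum, Finset.sum_apply]
    refine Finset.sum_congr rfl fun t _ => ?_
    simp [Matrix.mulVec_single]
  have h2 : star x ⬝ᵥ ((Matrix.diagonal d * a.map (Int.cast : ℤ → ℝ)).mulVec x) =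
      ∑ s ∈ S, (w s : ℝ) * (d (f s) * ∑ t ∈ S, (a (f s) (f t) : ℝ) * w t) := by
    rw [← Matrix.mulVec_mulVec]
    simp only [star_trivial, x, sum_dotProduct, single_dotProduct, Matrix.mulVec_diagonal]
    refine Finset.sum_congr rfl fun s _ => ?_
    rw [← hmv]
  rw [h2] at h1
  refine absurd h1 (not_lt.2 (Finset.sum_nonpos fun s hs => ?_))
  have h3 : (∑ t ∈ S, (a (f s) (f t) : ℝ) * w t) ≤ 0 := by exact_mod_cast hrow s hs
  have h4 : (0 : ℝ) ≤ w s := by exact_mod_cast (hw s hs).le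
  exact mul_nonpos_of_nonneg_of_nonpos h4 (mul_nonpos_of_nonneg_of_nonpos (hd _).le h3)

theorem IsFiniteCartanMatrix.adj_iff (ha : IsFiniteCartanMatrix a) {i j : ι} :
    (dynkinGraph a).Adj i j ↔ i ≠ j ∧ a i j ≠ 0 := by
  rw [dynkinGraph, SimpleGraph.fromRel_adj]
  have := ha.zero i j
  have := ha.zero j i
  tauto

theorem IsFiniteCartanMatrix.le_neg_one (ha : IsFiniteCartanMatrix a) {i j : ι} (hij : i ≠ j)
    (h : a i j ≠ 0) : a i j ≤ -1 := by
  have := ha.nonpos i j hij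
  omega

theorem IsFiniteCartanMatrix.symm_ne_zero (ha : IsFiniteCartanMatrix a) {i j : ι}
    (h : a i j ≠ 0) : a j i ≠ 0 := fun h' => h (ha.zero _ _ h')

/-- Around each vertex, the multiplicities `aᵢⱼaⱼᵢ` of the edges of the Dynkin diagram sum up to at
most `3`. -/
theorem IsFiniteCartanMatrix.sum_mul_le (ha : IsFiniteCartanMatrix a) (i : ι) (S : Finset ι)
    (hi : i ∉ S) : ∑ j ∈ S, a i j * a j i ≤ 3 := by
  by_contra! hlt
  have key : ∀ j ∈ S.filter (fun j => a j i ≠ 0), j ≠ i ∧ a j i ≤ -1 := by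
    intro j hj
    rw [Finset.mem_filter] at hj
    have hne : j ≠ i := fun e => hi (e ▸ hj.1)
    exact ⟨hne, ha.le_neg_one hne hj.2⟩
  have hi' : i ∉ S.filter (fun j => a j i ≠ 0) := fun h => hi (Finset.mem_filter.1 h).1
  -- the weights `2` at `i` and `-aⱼᵢ` at its neighbours `j` make the rows of the neighbours
  -- nonpositive
  refine ha.not_subharmonic (insert i (S.filter fun j => a j i ≠ 0)) id Function.injective_id.injOn
    (fun j => if j = i then 2 else - a j i) ?_ ⟨i, Finset.mem_insert_self _ _⟩ ?_
  · intro s hs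
    rcases Finset.mem_insert.1 hs with rfl | hs
    · simp
    · have := key s hs
      simp only [this.1, if_false]
      omega
  · intro s hs
    rcases Finset.mem_insert.1 hs with rfl | hs
    · refine ⟨_, Finset.Subset.refl _, Finset.mem_insert_self _ _, ?_⟩
      rw [Finset.sum_insert hi']
      have h1 : ∑ t ∈ S.filter (fun j => a j s ≠ 0), a (id s) (id t) * (if t = s then 2 else - a t s)
          = - ∑ j ∈ S, a s j * a j s := by
        rw [← Finset.sum_neg_distrib, Finset.sum_filter]
        refine Finset.sum_congr rfl fun t ht => ?_
        have hne : t ≠ s := fun e => hi (e ▸ ht)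
        by_cases h0 : a t s = 0
        · simp [h0]
        · simp [h0, hne]
      rw [h1]
      simp only [id, ha.diag, if_true]
      linarith
    · have hk := key s hs
      refine ⟨{s, i}, ?_, by simp, ?_⟩
      · intro t ht
        rcases Finset.mem_insert.1 ht with rfl | ht
        · exact Finset.mem_insert_of_mem hs
        · rw [Finset.mem_singleton.1 ht]; exact Finset.mem_insert_self _ _
      · rw [Finset.sum_pair hk.1]
        simp [hk.1, ha.diag]
        linarith

theorem IsFiniteCartanMatrix.mul_le (ha : IsFiniteCartanMatrix a) {i j : ι} (hij : i ≠ j) :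
    a i j * a j i ≤ 3 := by
  simpa using ha.sum_mul_le i {j} (by simpa using hij)

theorem IsFiniteCartanMatrix.mul_add_mul_le (ha : IsFiniteCartanMatrix a) {i j l : ι} (hij : i ≠ j)
    (hil : i ≠ l) (hjl : j ≠ l) : a i j * a j i + a i l * a l i ≤ 3 := by
  have := ha.sum_mul_le i {j, l} (by simp [hij, hil])
  rwa [Finset.sum_pair hjl] at this

theorem IsFiniteCartanMatrix.mul_add_mul_add_mul_le (ha : IsFiniteCartanMatrix a) {i j l m : ι}
    (hij : i ≠ j) (hil : i ≠ l) (him : i ≠ m) (hjl : j ≠ l) (hjm : j ≠ m) (hlm : l ≠ m) :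
    a i j * a j i + (a i l * a l i + a i m * a m i) ≤ 3 := by
  have := ha.sum_mul_le i {j, l, m} (by simp [hij, hil, him])
  rwa [Finset.sum_insert (by simp [hjl, hjm]), Finset.sum_pair hlm] at this

/-- The two possibilities for a multiple edge which is not triple. -/
theorem IsFiniteCartanMatrix.double_edge (ha : IsFiniteCartanMatrix a) {i j : ι} (hij : i ≠ j)
    (h : a i j * a j i = 2) : (a i j = -2 ∧ a j i = -1) ∨ (a i j = -1 ∧ a j i = -2) := by
  have h1 : a i j ≤ -1 := ha.le_neg_one hij fun h0 => by simp [h0] at h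
  have h2 : a j i ≤ -1 := ha.le_neg_one hij.symm fun h0 => by simp [h0] at h
  have h3 : -2 ≤ a i j := by nlinarith
  have h4 : -2 ≤ a j i := by nlinarith
  interval_cases a i j <;> interval_cases a j i <;> simp_all

theorem IsFiniteCartanMatrix.triple_edge (ha : IsFiniteCartanMatrix a) {i j : ι} (hij : i ≠ j)
    (h : a i j * a j i = 3) : (a i j = -3 ∧ a j i = -1) ∨ (a i j = -1 ∧ a j i = -3) := by
  have h1 : a i j ≤ -1 := ha.le_neg_one hij fun h0 => by simp [h0] at h
  have h2 : a j i ≤ -1 := ha.le_neg_one hij.symm fun h0 => by simp [h0] at h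
  have h3 : -3 ≤ a i j := by nlinarith
  have h4 : -3 ≤ a j i := by nlinarith
  interval_cases a i j <;> interval_cases a j i <;> simp_all

/-- The Dynkin diagram has no subdiagram containing the affine diagram `F₄⁽¹⁾` or `E₆⁽²⁾`. -/
theorem IsFiniteCartanMatrix.not_affine_F (ha : IsFiniteCartanMatrix a) (c : Fin 5 → ι)
    (hc : Function.Injective c) (h01 : a (c 0) (c 1) ≠ 0) (h12 : a (c 1) (c 2) ≠ 0)
    (h23 : a (c 2) (c 3) * a (c 3) (c 2) = 2) (h34 : a (c 3) (c 4) ≠ 0) : False := by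
  have hn : ∀ s t, s ≠ t → a (c s) (c t) ≤ 0 := fun s t h => ha.nonpos _ _ fun e => h (hc e)
  have hl : ∀ s t, s ≠ t → a (c s) (c t) ≠ 0 → a (c s) (c t) ≤ -1 ∧ a (c t) (c s) ≤ -1 :=
    fun s t h h' => ⟨ha.le_neg_one (fun e => h (hc e)) h',
      ha.le_neg_one (fun e => h (hc e.symm)) (ha.symm_ne_zero h')⟩
  obtain ⟨e1, e2⟩ := hl 0 1 (by decide) h01
  obtain ⟨e3, e4⟩ := hl 1 2 (by decide) h12
  obtain ⟨e5, e6⟩ := hl 3 4 (by decide) h34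
  -- the coefficients of the null vector at the last two vertices depend on the direction of the
  -- double edge
  obtain ⟨u, v, hu, hv, huv, h2, h3⟩ : ∃ u v : ℤ, 0 < u ∧ 0 < v ∧ 2 * v ≤ u ∧
      4 + a (c 2) (c 3) * u ≤ 0 ∧ a (c 3) (c 2) * 3 + 2 * u ≤ v := by
    rcases ha.double_edge (fun e => absurd (hc e) (by decide)) h23 with ⟨h1, h2⟩ | ⟨h1, h2⟩
    · exact ⟨2, 1, by norm_num, by norm_num, by norm_num, by rw [h1]; norm_num,
        by rw [h2]; norm_num⟩
    · exact ⟨4, 2, by norm_num, by norm_num, by norm_num, by rw [h1]; norm_num,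
        by rw [h2]; norm_num⟩
  refine ha.not_subharmonic Finset.univ c hc.injOn ![1, 2, 3, u, v] ?_ ⟨0, by simp⟩ ?_
  · intro s _; fin_cases s <;> simp [hu, hv]
  · intro s _
    fin_cases s
    · refine ⟨{0, 1}, by simp, by simp, ?_⟩
      rw [Finset.sum_pair (by decide)]
      simp [ha.diag]; linarith
    · refine ⟨{0, 1, 2}, by simp, by simp, ?_⟩
      rw [Finset.sum_insert (by decide), Finset.sum_pair (by decide)]
      simp [ha.diag]; linarith
    · refine ⟨{1, 2, 3}, by simp, by simp, ?_⟩
      rw [Finset.sum_insert (by decide), Finset.sum_pair (by decide)]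
      simp [ha.diag]; linarith
    · refine ⟨{2, 3, 4}, by simp, by simp, ?_⟩
      rw [Finset.sum_insert (by decide), Finset.sum_pair (by decide)]
      simp [ha.diag]; nlinarith
    · refine ⟨{3, 4}, by simp, by simp, ?_⟩
      rw [Finset.sum_pair (by decide)]
      simp [ha.diag]; nlinarith

end Cartan

/-! ### Components with a multiple edge -/

section Cartan

variable {ι : Type*} {a : Matrix ι ι ℤ}

theorem isOfType_of_range_eq {I : Set ι} {n : ℕ} {c : Matrix (Fin n) (Fin n) ℤ} (h : Fin n → ι)
    (hinj : Function.Injective h) (hI : Set.range h = I) (hc : ∀ s t, a (h s) (h t) = c s t) :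
    IsOfType a I c :=
  ⟨(Equiv.ofInjective h hinj).trans (Equiv.setCongr hI), hc⟩

/-- The vertices `f 0, …, f (n - 1)` form a chain: the first edge is a double edge, with entries
`p` and `r`, the other edges are simple. Thus a chain is a subdiagram of type `Cₙ` or `Bₙ`,
numbered backwards. -/
structure IsDoubleChain (a : Matrix ι ι ℤ) (p r : ℤ) (n : ℕ) (f : ℕ → ι) : Prop where
  two_le : 2 ≤ n
  injOn : ∀ s t, s < n → t < n → f s = f t → s = t
  zero_one : a (f 0) (f 1) = p
  one_zero : a (f 1) (f 0) = r
  double : p = -2 ∧ r = -1 ∨ p = -1 ∧ r = -2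
  succ : ∀ s, 1 ≤ s → s + 1 < n → a (f s) (f (s + 1)) = -1 ∧ a (f (s + 1)) (f s) = -1
  far : ∀ s t, s + 1 < t → t < n → a (f s) (f t) = 0 ∧ a (f t) (f s) = 0

namespace IsDoubleChain

variable {p r : ℤ} {n : ℕ} {f : ℕ → ι}

/-- A chain of two vertices can be read backwards. -/
theorem swap (hf : IsDoubleChain a p r n f) : IsDoubleChain a r p 2 (fun s => f (1 - s)) where
  two_le := le_rfl
  injOn s t hs ht h := by
    have := hf.two_le
    have := hf.injOn (1 - s) (1 - t) (by omega) (by omega) h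
    omega
  zero_one := hf.one_zero
  one_zero := hf.zero_one
  double := hf.double.symm.imp And.symm And.symm
  succ s hs h := by omega
  far s t hst ht := by omega

theorem adj (hf : IsDoubleChain a p r n f) (s : ℕ) (hs : s + 1 < n) :
    a (f s) (f (s + 1)) ≤ -1 ∧ a (f (s + 1)) (f s) ≤ -1 := by
  rcases Nat.eq_zero_or_pos s with rfl | h
  · rw [hf.zero_one, hf.one_zero]
    have := hf.double
    omega
  · have := hf.succ s h hs
    omega

theorem ne (hf : IsDoubleChain a p r n f) {s t : ℕ} (hs : s < n) (ht : t < n) (h : s ≠ t) :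
    f s ≠ f t := fun e => h (hf.injOn s t hs ht e)

end IsDoubleChain

variable [Fintype ι] [DecidableEq ι]

/-- A set of vertices which is connected and closed under adjacency is a connected component. -/
theorem IsFiniteCartanMatrix.range_eq_supp (ha : IsFiniteCartanMatrix a) {κ : Type*} (h : κ → ι)
    (s₀ : κ) (hr : ∀ s, (dynkinGraph a).Reachable (h s₀) (h s))
    (hcl : ∀ s v, a (h s) v ≠ 0 → v ∈ Set.range h) :
    Set.range h = ((dynkinGraph a).connectedComponentMk (h s₀)).supp := by
  ext v
  rw [SimpleGraph.ConnectedComponent.mem_supp_iff, SimpleGraph.ConnectedComponent.eq]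
  constructor
  · rintro ⟨s, rfl⟩
    exact (hr s).symm
  · rintro hv
    have key : ∀ u w, (dynkinGraph a).Walk u w → w ∈ Set.range h → u ∈ Set.range h := by
      intro u w p hw
      induction p with
      | nil => exact hw
      | cons hadj p ih =>
        obtain ⟨s, hs⟩ := ih hw
        apply hcl s
        rw [hs]
        exact (ha.adj_iff.1 hadj.symm).2
    exact key _ _ hv.some ⟨s₀, rfl⟩

namespace IsDoubleChain

variable {p r : ℤ} {n : ℕ} {f : ℕ → ι}

theorem reachable (ha : IsFiniteCartanMatrix a) (hf : IsDoubleChain a p r n f) (s : ℕ)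
    (hs : s < n) : (dynkinGraph a).Reachable (f 0) (f s) := by
  induction s with
  | zero => exact SimpleGraph.Reachable.refl _
  | succ s ih =>
    refine (ih (by omega)).trans (SimpleGraph.Adj.reachable (ha.adj_iff.2 ⟨?_, ?_⟩))
    · exact hf.ne (by omega) hs (by omega)
    · have := hf.adj s hs
      omega

/-- The common part of the affine diagrams in which a chain `f 0, …, f s` is followed by further
vertices `e ∈ E` attached to `f s`. -/
theorem false_of_attached (ha : IsFiniteCartanMatrix a) (hf : IsDoubleChain a p r n f) {s : ℕ}
    (hs : 1 ≤ s) (hsn : s < n) (E : Finset ι) (z : ι → ℤ) (hE : ∀ e ∈ E, ∀ t ≤ s, f t ≠ e)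
    (hz : ∀ e ∈ E, 0 < z e) (h1 : 2 + ∑ e ∈ E, a (f s) e * z e ≤ 0)
    (h2 : ∀ e ∈ E, a e (f s) + z e ≤ 0) : False := by
  have hd := hf.double
  refine ha.not_subharmonic ((Finset.range (s + 1)).disjSum E) (Sum.elim f id) ?_
    (Sum.elim (fun t => if t = 0 then -p else 2) z) ?_ ⟨Sum.inl 0, by simp⟩ ?_
  · rintro (t | e) ht (t' | e') ht' h
    · simp only [Finset.mem_coe, Finset.inl_mem_disjSum, Finset.mem_range] at ht ht'
      rw [hf.injOn t t' (by omega) (by omega) h]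
    · simp only [Finset.mem_coe, Finset.inl_mem_disjSum, Finset.inr_mem_disjSum,
        Finset.mem_range] at ht ht'
      exact absurd h (hE e' ht' t (by omega))
    · simp only [Finset.mem_coe, Finset.inl_mem_disjSum, Finset.inr_mem_disjSum,
        Finset.mem_range] at ht ht'
      exact absurd h.symm (hE e ht t' (by omega))
    · exact congrArg _ h
  · rintro (t | e) ht
    · simp only [Sum.elim_inl]
      split_ifs <;> omega
    · exact hz e (by simpa using ht)
  · rintro (t | e) ht
    · rw [Finset.inl_mem_disjSum, Finset.mem_range] at ht
      rcases Nat.eq_zero_or_pos t with rfl | h0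
      · refine ⟨{Sum.inl 0, Sum.inl 1}, ?_, by simp, ?_⟩
        · intro x hx
          simp only [Finset.mem_insert, Finset.mem_singleton] at hx
          rcases hx with rfl | rfl
          · simp
          · simp only [Finset.inl_mem_disjSum, Finset.mem_range]; omega
        · rw [Finset.sum_pair (by simp)]
          simp [ha.diag, hf.zero_one]
          omega
      · obtain ⟨t, rfl⟩ : ∃ t', t = t' + 1 := ⟨t - 1, by omega⟩
        -- the contribution of the preceding vertex is `-2` also at `t = 0`, as `p * r = 2`
        have hprev : a (f (t + 1)) (f t) * (if t = 0 then -p else 2) = -2 := by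
          split_ifs with h
          · rw [h, hf.one_zero]
            rcases hd with ⟨hp, hr⟩ | ⟨hp, hr⟩ <;> rw [hp, hr] <;> norm_num
          · rw [(hf.succ t (by omega) (by omega)).2]; norm_num
        rcases Nat.lt_or_ge (t + 1) s with hts | hts
        · refine ⟨{Sum.inl t, Sum.inl (t + 1), Sum.inl (t + 2)}, ?_, by simp, ?_⟩
          · intro x hx
            simp only [Finset.mem_insert, Finset.mem_singleton] at hx
            rcases hx with rfl | rfl | rfl <;> simp <;> omega
          · rw [Finset.sum_insert (by simp), Finset.sum_pair (by simp)]
            have := (hf.succ (t + 1) (by omega) (by omega)).1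
            simp only [Sum.elim_inl, hprev]
            simp [ha.diag, this]
        · obtain rfl : s = t + 1 := by omega
          refine ⟨insert (Sum.inl t) (insert (Sum.inl (t + 1)) (E.map ⟨Sum.inr, Sum.inr_injective⟩)),
            ?_, by simp, ?_⟩
          · intro x hx
            simp only [Finset.mem_insert, Finset.mem_map, Function.Embedding.coeFn_mk] at hx
            rcases hx with rfl | rfl | ⟨e, he, rfl⟩
            · simp
            · simp
            · simpa using he
          · rw [Finset.sum_insert (by simp), Finset.sum_insert (by simp), Finset.sum_map]
            simp only [Sum.elim_inl, hprev, Function.Embedding.coeFn_mk, Sum.elim_inr, id, ha.diag]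
            simp only [Nat.add_eq_zero_iff, one_ne_zero, and_false, if_false]
            linarith
    · have he : e ∈ E := by simpa using ht
      refine ⟨{Sum.inl s, Sum.inr e}, ?_, by simp, ?_⟩
      · intro x hx
        simp only [Finset.mem_insert, Finset.mem_singleton] at hx
        rcases hx with rfl | rfl
        · simp
        · simpa using he
      · rw [Finset.sum_pair (by simp)]
        have := h2 e he
        have hs0 : s ≠ 0 := by omega
        simp [ha.diag, hs0]
        linarith

/-- A further vertex is not attached to an interior vertex of a chain. -/
theorem apply_eq_zero_of_interior (ha : IsFiniteCartanMatrix a) (hf : IsDoubleChain a p r n f)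
    {v : ι} (hv : ∀ t < n, f t ≠ v) {s : ℕ} (hs : 1 ≤ s) (hsn : s + 1 < n) : a (f s) v = 0 := by
  by_contra h
  have h1 := ha.le_neg_one (hv s (by omega)) h
  have h2 := ha.le_neg_one (hv s (by omega)).symm (ha.symm_ne_zero h)
  have h3 := hf.succ s hs hsn
  refine hf.false_of_attached ha hs (by omega) {v, f (s + 1)} (fun _ => 1) ?_ (by simp) ?_ ?_
  · intro e he t ht
    rcases Finset.mem_insert.1 he with rfl | he
    · exact hv t (by omega)
    · rw [Finset.mem_singleton.1 he]
      exact hf.ne (by omega) hsn (by omega)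
  · rw [Finset.sum_pair (hv _ hsn).symm]
    omega
  · intro e he
    rcases Finset.mem_insert.1 he with rfl | he
    · omega
    · rw [Finset.mem_singleton.1 he]
      omega

/-- A further vertex is attached to the end of a chain by a simple edge at most. -/
theorem apply_last (ha : IsFiniteCartanMatrix a) (hf : IsDoubleChain a p r (n + 1) f)
    {v : ι} (hv : ∀ t < n + 1, f t ≠ v) (h : a (f n) v ≠ 0) : a (f n) v = -1 ∧ a v (f n) = -1 := by
  have hn := hf.two_le
  have h1 := ha.le_neg_one (hv n (by omega)) h
  have h2 := ha.le_neg_one (hv n (by omega)).symm (ha.symm_ne_zero h)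
  by_contra hne
  -- the weight of `v` depends on the direction of the multiple edge
  obtain ⟨z, hz, hz1, hz2⟩ : ∃ z : ℤ, 0 < z ∧ 2 + a (f n) v * z ≤ 0 ∧ a v (f n) + z ≤ 0 := by
    rcases lt_or_eq_of_le h1 with h3 | h3
    · exact ⟨1, by omega, by omega, by omega⟩
    · exact ⟨2, by omega, by omega, by omega⟩
  refine hf.false_of_attached ha (s := n) (by omega) (by omega) {v} (fun _ => z) ?_
    (by simpa using hz) (by simpa using hz1) (by simpa using hz2)
  intro e he t ht
  rw [Finset.mem_singleton.1 he]
  exact hv t (by omega)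

/-- A further vertex does not close a chain to a cycle. -/
theorem apply_zero_or_apply_last (ha : IsFiniteCartanMatrix a)
    (hf : IsDoubleChain a p r (n + 1) f) {v : ι} (hv : ∀ t < n + 1, f t ≠ v) :
    a (f 0) v = 0 ∨ a (f n) v = 0 := by
  by_contra! h
  have hn := hf.two_le
  have h1 := ha.le_neg_one (hv n (by omega)) h.2
  have h2 := ha.le_neg_one (hv n (by omega)).symm (ha.symm_ne_zero h.2)
  have h3 := ha.le_neg_one (hv 0 (by omega)) h.1
  have h4 := ha.le_neg_one (hv 0 (by omega)).symm (ha.symm_ne_zero h.1)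
  have hu : ∀ t < n + 1, Function.update f (n + 1) v t = f t := fun t ht =>
    Function.update_of_ne (by omega) _ _
  have hu' : Function.update f (n + 1) v (n + 1) = v := Function.update_self _ _ _
  -- on a cycle every row has two negative off-diagonal entries, so that all weights can be `1`
  refine ha.not_subharmonic (Finset.range (n + 2)) (Function.update f (n + 1) v) ?_ (fun _ => 1)
    (by simp) ⟨0, by simp⟩ ?_
  · intro s hs t ht hst
    simp only [Finset.coe_range, Set.mem_Iio] at hs ht
    rcases Nat.lt_or_ge s (n + 1) with h5 | h5 <;> rcases Nat.lt_or_ge t (n + 1) with h6 | h6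
    · rw [hu s h5, hu t h6] at hst
      exact hf.injOn s t h5 h6 hst
    · rw [hu s h5, show t = n + 1 by omega, hu'] at hst
      exact absurd hst (hv s h5)
    · rw [hu t h6, show s = n + 1 by omega, hu'] at hst
      exact absurd hst.symm (hv t h6)
    · omega
  · have sub : ∀ x y z : ℕ, x < n + 2 → y < n + 2 → z < n + 2 →
        ({x, y, z} : Finset ℕ) ⊆ Finset.range (n + 2) := by
      intro x y z hx hy hz t ht
      simp only [Finset.mem_insert, Finset.mem_singleton] at ht
      rcases ht with rfl | rfl | rfl <;> simpa
    intro s hs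
    rw [Finset.mem_range] at hs
    obtain rfl | rfl | rfl | hs' : s = 0 ∨ s = n ∨ s = n + 1 ∨ (0 < s ∧ s < n) := by omega
    · refine ⟨{0, 1, n + 1}, sub _ _ _ (by omega) (by omega) (by omega), by simp, ?_⟩
      have := hf.adj 0 (by omega)
      rw [Finset.sum_insert (by simp), Finset.sum_pair (by omega), hu', hu 0 (by omega),
        hu 1 (by omega), ha.diag]
      simp only [zero_add] at this
      omega
    · refine ⟨{s - 1, s, s + 1}, sub _ _ _ (by omega) (by omega) (by omega), by simp, ?_⟩
      have := hf.adj (s - 1) (by omega)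
      rw [Nat.sub_add_cancel (by omega)] at this
      rw [Finset.sum_insert (by simp; omega), Finset.sum_pair (by omega), hu', hu s (by omega),
        hu (s - 1) (by omega), ha.diag]
      omega
    · refine ⟨{0, n, n + 1}, sub _ _ _ (by omega) (by omega) (by omega), by simp, ?_⟩
      rw [Finset.sum_insert (by simp; omega), Finset.sum_pair (by omega), hu', hu 0 (by omega),
        hu n (by omega), ha.diag]
      omega
    · refine ⟨{s - 1, s, s + 1}, sub _ _ _ (by omega) (by omega) (by omega), by simp, ?_⟩
      have h5 := hf.adj (s - 1) (by omega)
      have h6 := hf.adj s (by omega)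
      rw [Nat.sub_add_cancel (by omega)] at h5
      rw [Finset.sum_insert (by simp; omega), Finset.sum_pair (by omega), hu s (by omega),
        hu (s - 1) (by omega), hu (s + 1) (by omega), ha.diag]
      omega

/-- A vertex which is attached only to the end of a chain extends the chain. -/
theorem extend (ha : IsFiniteCartanMatrix a) (hf : IsDoubleChain a p r (n + 1) f)
    {v : ι} (hv : ∀ t < n + 1, f t ≠ v) (h : a (f n) v ≠ 0) (h0 : ∀ t < n, a (f t) v = 0) :
    IsDoubleChain a p r (n + 2) (Function.update f (n + 1) v) := by
  have hn := hf.two_le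
  have hu : ∀ t < n + 1, Function.update f (n + 1) v t = f t := fun t ht =>
    Function.update_of_ne (by omega) _ _
  have hu' : Function.update f (n + 1) v (n + 1) = v := Function.update_self _ _ _
  refine ⟨by omega, ?_, ?_, ?_, hf.double, ?_, ?_⟩
  · intro s t hs ht hst
    rcases Nat.lt_or_ge s (n + 1) with h5 | h5 <;> rcases Nat.lt_or_ge t (n + 1) with h6 | h6
    · rw [hu s h5, hu t h6] at hst
      exact hf.injOn s t h5 h6 hst
    · rw [hu s h5, show t = n + 1 by omega, hu'] at hst
      exact absurd hst (hv s h5)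
    · rw [hu t h6, show s = n + 1 by omega, hu'] at hst
      exact absurd hst.symm (hv t h6)
    · omega
  · rw [hu 0 (by omega), hu 1 (by omega), hf.zero_one]
  · rw [hu 0 (by omega), hu 1 (by omega), hf.one_zero]
  · intro s hs hsn
    rcases Nat.lt_or_ge (s + 1) (n + 1) with h5 | h5
    · rw [hu s (by omega), hu (s + 1) h5]
      exact hf.succ s hs h5
    · obtain rfl : s = n := by omega
      rw [hu', hu s (by omega)]
      exact hf.apply_last ha hv h
  · intro s t hst ht
    rcases Nat.lt_or_ge t (n + 1) with h5 | h5
    · rw [hu s (by omega), hu t h5]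
      exact hf.far s t hst h5
    · obtain rfl : t = n + 1 := by omega
      rw [hu', hu s (by omega)]
      exact ⟨h0 s (by omega), ha.zero _ _ (h0 s (by omega))⟩

/-- A chain which is closed under adjacency is a component of type `Bₙ` or `Cₙ`. -/
theorem isOfType_of_closed (ha : IsFiniteCartanMatrix a) (hf : IsDoubleChain a p r n f)
    (hcl : ∀ v, (∀ s < n, f s ≠ v) → ∀ s < n, a (f s) v = 0) :
    IsOfTypeBCF a ((dynkinGraph a).connectedComponentMk (f 0)).supp := by
  have hn := hf.two_le
  let h : Fin n → ι := fun s => f (n - 1 - s)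
  have hinj : Function.Injective h := by
    intro s t hst
    have := hf.injOn _ _ (by omega) (by omega) hst
    omega
  have h0 : h ⟨n - 1, by omega⟩ = f 0 := congrArg f (by simp)
  have hr : ∀ s, (dynkinGraph a).Reachable (h ⟨n - 1, by omega⟩) (h s) := by
    intro s
    rw [h0]
    exact hf.reachable ha _ (by omega)
  have hrange := ha.range_eq_supp h ⟨n - 1, by omega⟩ hr (by
    intro s v hv
    by_contra hvr
    refine hv (hcl v ?_ _ (by omega))
    intro t ht htv
    refine hvr ⟨⟨n - 1 - t, by omega⟩, ?_⟩
    rw [← htv]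
    exact congrArg f (by simp; omega))
  rw [h0] at hrange
  have hent : ∀ s t : Fin n, (s : ℕ) < t →
      (a (h s) (h t) = if (s : ℕ) + 1 = t then (if (t : ℕ) = n - 1 then r else -1) else 0) ∧
      (a (h t) (h s) = if (s : ℕ) + 1 = t then (if (t : ℕ) = n - 1 then p else -1) else 0) := by
    intro s t hst
    by_cases h1 : (s : ℕ) + 1 = t
    · by_cases h2 : (t : ℕ) = n - 1
      · have e1 : h s = f 1 := congrArg f (by omega)
        have e2 : h t = f 0 := congrArg f (by omega)
        rw [e1, e2, if_pos h1, if_pos h1, if_pos h2, if_pos h2]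
        exact ⟨hf.one_zero, hf.zero_one⟩
      · have e1 : h s = f (n - 1 - t + 1) := congrArg f (by omega)
        rw [e1, if_pos h1, if_pos h1, if_neg h2, if_neg h2]
        exact (hf.succ (n - 1 - t) (by omega) (by omega)).symm
    · rw [if_neg h1, if_neg h1]
      exact (hf.far _ _ (by omega) (by omega)).symm
  refine Or.inl ⟨n, hn, ?_⟩
  rcases hf.double with ⟨hp, hr⟩ | ⟨hp, hr⟩
  · refine Or.inr (isOfType_of_range_eq h hinj hrange fun s t => ?_)
    rcases lt_trichotomy (s : ℕ) t with hst | hst | hst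
    · rw [(hent s t hst).1]
      simp only [CartanMatrix.C, Matrix.of_apply, Fin.ext_iff]
      split_ifs <;> omega
    · rw [Fin.ext hst, ha.diag]
      simp
    · rw [(hent t s hst).2]
      simp only [CartanMatrix.C, Matrix.of_apply, Fin.ext_iff]
      split_ifs <;> omega
  · refine Or.inl (isOfType_of_range_eq h hinj hrange fun s t => ?_)
    rcases lt_trichotomy (s : ℕ) t with hst | hst | hst
    · rw [(hent s t hst).1]
      simp only [CartanMatrix.B, Matrix.of_apply, Fin.ext_iff]
      split_ifs <;> omega
    · rw [Fin.ext hst, ha.diag]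
      simp
    · rw [(hent t s hst).2]
      simp only [CartanMatrix.B, Matrix.of_apply, Fin.ext_iff]
      split_ifs <;> omega

end IsDoubleChain

/-- A subdiagram of type `F₄` is a whole component. -/
theorem IsFiniteCartanMatrix.isOfType_F₄ (ha : IsFiniteCartanMatrix a) (c : Fin 4 → ι)
    (hc : Function.Injective c) (h : ∀ s t, a (c s) (c t) = CartanMatrix.F₄ s t) (s : Fin 4) :
    IsOfTypeBCF a ((dynkinGraph a).connectedComponentMk (c s)).supp := by
  refine Or.inr (isOfType_of_range_eq c hc ?_ h)
  have hadj : ∀ s t, s ≠ t → CartanMatrix.F₄ s t ≠ 0 → (dynkinGraph a).Reachable (c s) (c t) :=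
    fun s t h1 h2 => (ha.adj_iff.2 ⟨fun e => h1 (hc e), by rwa [h]⟩).reachable
  have h01 := hadj 0 1 (by decide) (by decide)
  have h12 := hadj 1 2 (by decide) (by decide)
  have h23 := hadj 2 3 (by decide) (by decide)
  have hr : ∀ t, (dynkinGraph a).Reachable (c 0) (c t) := by
    intro t
    fin_cases t
    exacts [.refl _, h01, h01.trans h12, (h01.trans h12).trans h23]
  refine ha.range_eq_supp c s (fun t => (hr s).symm.trans (hr t)) ?_
  intro t v hv
  by_contra hvr
  have hne : ∀ t, c t ≠ v := fun t e => hvr ⟨t, e⟩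
  have h1 := ha.le_neg_one (hne t) hv
  have h2 := ha.le_neg_one (hne t).symm (ha.symm_ne_zero hv)
  have hinj : ∀ c' : Fin 4 → ι, Function.Injective c' → (∀ t, c' t ≠ v) →
      Function.Injective (Fin.cons v c' : Fin 5 → ι) := fun c' h1 h2 =>
    Fin.cons_injective_iff.2 ⟨fun ⟨t, ht⟩ => h2 t ht, h1⟩
  have e := h
  fin_cases t
  · refine ha.not_affine_F (Fin.cons v c) (hinj c hc hne) (ha.symm_ne_zero hv) ?_ ?_ ?_
    · exact (h 0 1).trans_ne (by decide)
    · exact (congrArg₂ (· * ·) (h 1 2) (h 2 1)).trans (by decide)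
    · exact (h 2 3).trans_ne (by decide)
  · have := ha.mul_add_mul_add_mul_le (hne 1) (fun e => absurd (hc e) (by decide))
      (fun e => absurd (hc e) (by decide)) (hne 0).symm (hne 2).symm
      (fun e => absurd (hc e) (by decide))
    rw [h, h, h, h] at this
    simp [CartanMatrix.F₄] at this h1 h2
    nlinarith
  · have := ha.mul_add_mul_add_mul_le (hne 2) (fun e => absurd (hc e) (by decide))
      (fun e => absurd (hc e) (by decide)) (hne 1).symm (hne 3).symm
      (fun e => absurd (hc e) (by decide))
    rw [h, h, h, h] at this
    simp [CartanMatrix.F₄] at this h1 h2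
    nlinarith
  · refine ha.not_affine_F (Fin.cons v (c ∘ Fin.rev)) (hinj _ (hc.comp Fin.rev_injective)
      fun t => hne _) (ha.symm_ne_zero hv) ?_ ?_ ?_
    · exact (h 3 2).trans_ne (by decide)
    · exact (congrArg₂ (· * ·) (h 2 1) (h 1 2)).trans (by decide)
    · exact (h 1 0).trans_ne (by decide)

/-- A chain `f 0, f 1, f 2` with a further vertex attached to `f 0` lies in a component of type
`F₄`. -/
theorem IsDoubleChain.isOfType_F₄ (ha : IsFiniteCartanMatrix a) {p r : ℤ} {f : ℕ → ι}
    (hf : IsDoubleChain a p r 3 f) {v : ι} (hv : ∀ t < 3, f t ≠ v) (h : a (f 0) v ≠ 0) :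
    IsOfTypeBCF a ((dynkinGraph a).connectedComponentMk (f 0)).supp := by
  have h0 := hf.swap.apply_last (n := 1) ha (v := v) (fun t ht => hv _ (by omega)) h
  have h1 : a (f 1) v = 0 := hf.apply_eq_zero_of_interior ha hv le_rfl (by norm_num)
  have h2 : a (f 2) v = 0 := (hf.apply_zero_or_apply_last (n := 2) ha hv).resolve_left h
  have h1' := ha.zero _ _ h1
  have h2' := ha.zero _ _ h2
  obtain ⟨e1, e2⟩ := hf.succ 1 le_rfl (by norm_num)
  obtain ⟨e3, e4⟩ := hf.far 0 2 (by norm_num) (by norm_num)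
  have e5 := hf.zero_one
  have e6 := hf.one_zero
  simp only [Nat.sub_self, Nat.reduceAdd] at h0 e1 e2
  have n01 : f 0 ≠ f 1 := hf.ne (by norm_num) (by norm_num) (by norm_num)
  have n02 : f 0 ≠ f 2 := hf.ne (by norm_num) (by norm_num) (by norm_num)
  have n12 : f 1 ≠ f 2 := hf.ne (by norm_num) (by norm_num) (by norm_num)
  have n0 := hv 0 (by norm_num)
  have n1 := hv 1 (by norm_num)
  have n2 := hv 2 (by norm_num)
  have hinj : Function.Injective ![v, f 0, f 1, f 2] := by
    intro s t
    fin_cases s <;> fin_cases t <;>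
      simp [n0, n1, n2, n01, n02, n12, n0.symm, n1.symm, n2.symm, n01.symm, n02.symm, n12.symm]
  rcases hf.double with ⟨hp, hr⟩ | ⟨hp, hr⟩
  · refine ha.isOfType_F₄ ![v, f 0, f 1, f 2] hinj (fun s t => ?_) 1
    fin_cases s <;> fin_cases t <;>
      simp [CartanMatrix.F₄, ha.diag, h0, h1, h2, h1', h2', e1, e2, e3, e4, e5, e6, hp, hr]
  · refine ha.isOfType_F₄ (![v, f 0, f 1, f 2] ∘ Fin.rev) (hinj.comp Fin.rev_injective)
      (fun s t => ?_) 2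
    fin_cases s <;> fin_cases t <;>
      simp [CartanMatrix.F₄, ha.diag, h0, h1, h2, h1', h2', e1, e2, e3, e4, e5, e6, hp, hr, Fin.rev]

/-- A chain can be extended until it is a component of type `Bₙ` or `Cₙ`, unless it lies in a
component of type `F₄`. -/
theorem IsDoubleChain.isOfTypeBCF (ha : IsFiniteCartanMatrix a) {p r : ℤ} {n : ℕ} {f : ℕ → ι}
    (hf : IsDoubleChain a p r n f) :
    IsOfTypeBCF a ((dynkinGraph a).connectedComponentMk (f 0)).supp := by
  induction hm : Fintype.card ι - n generalizing n f p r with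
  | zero =>
    refine hf.isOfType_of_closed ha fun v hv => ?_
    -- there is no vertex outside the chain
    exfalso
    have h : Function.Injective (Fin.cons v fun s : Fin n => f s : Fin (n + 1) → ι) :=
      Fin.cons_injective_iff.2 ⟨fun ⟨t, ht⟩ => hv t t.2 ht, fun s t h =>
        Fin.ext (hf.injOn s t s.2 t.2 h)⟩
    have := Fintype.card_le_of_injective _ h
    simp only [Fintype.card_fin] at this
    omega
  | succ m ih =>
    have hn := hf.two_le
    by_cases hcl : ∀ v, (∀ s < n, f s ≠ v) → ∀ s < n, a (f s) v = 0
    · exact hf.isOfType_of_closed ha hcl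
    push Not at hcl
    obtain ⟨v, hv, s, hs, hsv⟩ := hcl
    obtain ⟨n, rfl⟩ : ∃ n', n = n' + 1 := ⟨n - 1, by omega⟩
    have hint : ∀ t, 1 ≤ t → t < n → a (f t) v = 0 := fun t ht htn =>
      hf.apply_eq_zero_of_interior ha hv ht (by omega)
    rcases hf.apply_zero_or_apply_last ha hv with h0 | h0
    · have hlast : a (f n) v ≠ 0 := by
        rcases Nat.eq_zero_or_pos s with rfl | h
        · exact absurd h0 hsv
        · obtain rfl : s = n := by
            by_contra hne
            exact hsv (hint s h (by omega))
          exact hsv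
      have := ih (hf.extend ha hv hlast fun t ht => by
        rcases Nat.eq_zero_or_pos t with rfl | h
        · exact h0
        · exact hint t h ht) (by omega)
      rwa [Function.update_of_ne (by omega)] at this
    · have hzero : a (f 0) v ≠ 0 := by
        rcases Nat.eq_zero_or_pos s with rfl | h
        · exact hsv
        · rcases Nat.lt_or_ge s n with h1 | h1
          · exact absurd (hint s h h1) hsv
          · obtain rfl : s = n := by omega
            exact absurd h0 hsv
      obtain rfl | rfl | hn4 : n = 1 ∨ n = 2 ∨ 3 ≤ n := by omega
      · have := ih (hf.swap.extend (n := 1) ha (v := v) (fun t ht => hv _ (by omega)) hzero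
          fun t ht => by
            obtain rfl : t = 0 := by omega
            exact h0) (by omega)
        rw [Function.update_of_ne (by norm_num)] at this
        rwa [SimpleGraph.ConnectedComponent.sound (hf.reachable ha 1 (by norm_num))]
      · exact hf.isOfType_F₄ ha hv hzero
      · exfalso
        refine ha.not_affine_F ![f 3, f 2, f 1, f 0, v] ?_ ?_ ?_ ?_ hzero
        · have hne : ∀ s t, s < 4 → t < 4 → f s = f t → s = t := fun s t hs ht =>
            hf.injOn s t (by omega) (by omega)
          have n0 := hv 0 (by omega)
          have n1 := hv 1 (by omega)
          have n2 := hv 2 (by omega)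
          have n3 := hv 3 (by omega)
          intro s t hst
          fin_cases s <;> fin_cases t <;>
            first
              | rfl
              | exact absurd hst (by assumption)
              | exact absurd hst.symm (by assumption)
              | exact absurd (hne _ _ (by norm_num) (by norm_num) hst) (by norm_num)
        · exact (hf.succ 2 (by norm_num) (by omega)).2.trans_ne (by norm_num)
        · exact (hf.succ 1 (by norm_num) (by omega)).2.trans_ne (by norm_num)
        · refine (congrArg₂ (· * ·) hf.one_zero hf.zero_one).trans ?_
          rcases hf.double with ⟨hp, hr⟩ | ⟨hp, hr⟩ <;> rw [hp, hr] <;> norm_num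

/-- A component of the Dynkin diagram with a double edge is of type `Bₙ`, `Cₙ` or `F₄`. -/
theorem IsFiniteCartanMatrix.isOfTypeBCF (ha : IsFiniteCartanMatrix a) {i j : ι} (hij : i ≠ j)
    (h : a i j * a j i = 2) : IsOfTypeBCF a ((dynkinGraph a).connectedComponentMk i).supp := by
  refine IsDoubleChain.isOfTypeBCF ha (f := fun s => if s = 0 then i else j) (p := a i j)
    (r := a j i) (n := 2) ⟨le_rfl, ?_, rfl, rfl, ha.double_edge hij h, ?_, ?_⟩
  · intro s t hs ht
    obtain rfl | rfl : s = 0 ∨ s = 1 := by omega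
    all_goals obtain rfl | rfl : t = 0 ∨ t = 1 := by omega
    all_goals simp [hij, hij.symm]
  · intro s _ _; omega
  · intro s t _ _; omega

/-- A triple edge of the Dynkin diagram is a whole component, of type `G₂`. -/
theorem IsFiniteCartanMatrix.isOfType_G₂ (ha : IsFiniteCartanMatrix a) {i j : ι} (hij : i ≠ j)
    (h : a i j * a j i = 3) :
    ((dynkinGraph a).connectedComponentMk i).supp = {i, j} ∧
      IsOfType a ((dynkinGraph a).connectedComponentMk i).supp CartanMatrix.G₂ := by
  have hout : ∀ {i j : ι}, i ≠ j → a i j * a j i = 3 → ∀ v, v ≠ i → v ≠ j → a i v = 0 := by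
    intro i j hij h v h1 h2
    by_contra h3
    have h4 := ha.le_neg_one h1.symm h3
    have h5 := ha.le_neg_one h1 (ha.symm_ne_zero h3)
    have := ha.mul_add_mul_le hij h1.symm h2.symm
    nlinarith
  have hadj : (dynkinGraph a).Adj i j := ha.adj_iff.2 ⟨hij, fun e => by simp [e] at h⟩
  have hrange : Set.range ![i, j] = ((dynkinGraph a).connectedComponentMk i).supp := by
    refine ha.range_eq_supp ![i, j] 0 ?_ ?_
    · intro s
      fin_cases s
      exacts [.refl _, hadj.reachable]
    · intro s v hv
      by_contra hvr
      simp only [Matrix.range_cons, Matrix.range_empty, Set.union_empty, Set.mem_union,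
        Set.mem_singleton_iff, not_or] at hvr
      fin_cases s
      · exact hv (hout hij h v hvr.1 hvr.2)
      · exact hv (hout hij.symm (by rwa [mul_comm]) v hvr.2 hvr.1)
  refine ⟨?_, ?_⟩
  · rw [← hrange]
    simp [Set.pair_comm]
  · rcases ha.triple_edge hij h with ⟨h1, h2⟩ | ⟨h1, h2⟩
    · refine isOfType_of_range_eq ![i, j] ?_ hrange ?_
      · intro s t
        fin_cases s <;> fin_cases t <;> simp [hij, hij.symm]
      · intro s t
        fin_cases s <;> fin_cases t <;> simp [CartanMatrix.G₂, ha.diag, h1, h2]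
    · refine isOfType_of_range_eq ![j, i] ?_ ?_ ?_
      · intro s t
        fin_cases s <;> fin_cases t <;> simp [hij, hij.symm]
      · rw [← hrange]
        simp [Set.pair_comm]
      · intro s t
        fin_cases s <;> fin_cases t <;> simp [CartanMatrix.G₂, ha.diag, h1, h2]

end Cartan

/-! ### Braidings of finite Cartan type -/

/-- An element `u ≠ 1` of odd order can only satisfy `u ^ m = 1` with `0 < |m| ≤ 5` or `|m| = 7` if
its order is `|m| = 3, 5, 7`. -/
theorem orderOf_eq_natAbs_of_zpow_eq_one {G : Type*} [Group G] {u : G} (hodd : Odd (orderOf u))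
    (hu : u ≠ 1) {m : ℤ} (h : u ^ m = 1) (h0 : m ≠ 0) (hm : m.natAbs ≤ 5 ∨ m.natAbs = 7) :
    orderOf u = m.natAbs ∧ (m.natAbs = 3 ∨ m.natAbs = 5 ∨ m.natAbs = 7) := by
  have h1 : orderOf u ∣ m.natAbs := Int.natCast_dvd.1 (orderOf_dvd_iff_zpow_eq_one.2 h)
  have h2 : orderOf u ≠ 1 := fun h => hu (orderOf_eq_one_iff.1 h)
  have h3 : 0 < m.natAbs := Int.natAbs_pos.2 h0
  generalize m.natAbs = M at *
  have h4 := Nat.le_of_dvd h3 h1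
  generalize orderOf u = N at *
  have h5 : M ≤ 7 := by omega
  obtain ⟨c, rfl⟩ := hodd
  have hc : c ≤ 3 := by omega
  interval_cases c <;> interval_cases M <;> omega

section Types

variable {ι : Type*} {a : Matrix ι ι ℤ} {G : Type*} [CommGroup G]

/-- In a component of type `Bₙ`, `Cₙ` or `F₄`, scalars with `qᵢ ^ aᵢⱼ = qⱼ ^ aⱼᵢ` take two values,
one of which is the square of the other. -/
theorem IsOfTypeBCF.exists_eq_or_eq_sq {I : Set ι} (hI : IsOfTypeBCF a I) (q : ι → G)
    (hq : ∀ i j, q i ^ a i j = q j ^ a j i) :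
    ∃ m ∈ I, ∀ v ∈ I, q v = q m ∨ q v = q m ^ 2 := by
  rcases hI with ⟨n, hn, hB | hC⟩ | ⟨f, hf⟩
  · obtain ⟨f, hf⟩ := hB
    have hq' : ∀ s t, q (f s) ^ CartanMatrix.B n s t = q (f t) ^ CartanMatrix.B n t s := by
      intro s t
      rw [← hf, ← hf, hq]
    have key : ∀ s (hs : s + 1 < n), q (f ⟨s, by omega⟩) = q (f ⟨0, by omega⟩) := by
      intro s
      induction s with
      | zero => intro _; rfl
      | succ s ih =>
        intro hs
        rw [← ih (by omega)]
        have := hq' ⟨s, by omega⟩ ⟨s + 1, by omega⟩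
        simp [CartanMatrix.B, show s + 1 ≠ n - 1 by omega, show s + 1 + 1 ≠ s by omega] at this
        exact this.symm
    refine ⟨f ⟨0, by omega⟩, (f _).2, fun v hv => ?_⟩
    obtain ⟨⟨s, hs⟩, hsv⟩ := f.surjective ⟨v, hv⟩
    have hv' : v = f ⟨s, hs⟩ := by rw [hsv]
    rw [hv']
    by_cases h : s + 1 < n
    · exact Or.inl (key s h)
    · right
      rw [← key (n - 2) (by omega)]
      have := hq' ⟨n - 2, by omega⟩ ⟨s, by omega⟩
      simp [CartanMatrix.B, show n - 2 + 1 = s by omega, show s = n - 1 by omega, show n - 2 ≠ n - 1 by omega,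
        show n - 1 ≠ n - 2 by omega, show n - 1 + 1 ≠ n - 2 by omega] at this
      simp only [show s = n - 1 by omega]
      exact this.symm
  · obtain ⟨f, hf⟩ := hC
    have hq' : ∀ s t, q (f s) ^ CartanMatrix.C n s t = q (f t) ^ CartanMatrix.C n t s := by
      intro s t
      rw [← hf, ← hf, hq]
    have key : ∀ s (hs : s + 1 < n), q (f ⟨s, by omega⟩) = q (f ⟨0, by omega⟩) := by
      intro s
      induction s with
      | zero => intro _; rfl
      | succ s ih =>
        intro hs
        rw [← ih (by omega)]
        have := hq' ⟨s, by omega⟩ ⟨s + 1, by omega⟩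
        simp [CartanMatrix.C, show s + 1 ≠ n - 1 by omega, show s + 1 + 1 ≠ s by omega] at this
        exact this.symm
    refine ⟨f ⟨n - 1, by omega⟩, (f _).2, fun v hv => ?_⟩
    obtain ⟨⟨s, hs⟩, hsv⟩ := f.surjective ⟨v, hv⟩
    have hv' : v = f ⟨s, hs⟩ := by rw [hsv]
    rw [hv']
    by_cases h : s + 1 < n
    · right
      rw [key s h, ← key (n - 2) (by omega)]
      have := hq' ⟨n - 2, by omega⟩ ⟨n - 1, by omega⟩
      simp [CartanMatrix.C, show n - 2 ≠ n - 1 by omega, show n - 2 + 1 = n - 1 by omega,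
        show n - 1 ≠ n - 2 by omega, show n - 1 + 1 ≠ n - 2 by omega] at this
      exact this
    · left
      simp only [show s = n - 1 by omega]
  · have hq' : ∀ s t, q (f s) ^ CartanMatrix.F₄ s t = q (f t) ^ CartanMatrix.F₄ t s := by
      intro s t
      rw [← hf, ← hf, hq]
    have h01 := hq' 0 1
    have h12 := hq' 1 2
    have h23 := hq' 2 3
    simp [CartanMatrix.F₄] at h01 h12 h23
    refine ⟨f 1, (f _).2, fun v hv => ?_⟩
    obtain ⟨s, hsv⟩ := f.surjective ⟨v, hv⟩
    have hv' : v = f s := by rw [hsv]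
    rw [hv']
    fin_cases s
    exacts [.inl h01, .inl rfl, .inr h12.symm, .inr (h23.symm.trans h12.symm)]

variable [Fintype ι] [DecidableEq ι]

/-- Scalars with `qᵢ ^ aᵢⱼ = qⱼ ^ aⱼᵢ` take at most two values on a component which is not of type
`G₂`, one of which is the square of the other. -/
theorem IsFiniteCartanMatrix.exists_eq_or_eq_sq (ha : IsFiniteCartanMatrix a) (q : ι → G)
    (hq : ∀ i j, q i ^ a i j = q j ^ a j i) (I : (dynkinGraph a).ConnectedComponent)
    (hI : ∀ u ∈ I.supp, ∀ v, u ≠ v → a u v * a v u ≠ 3) :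
    ∃ m ∈ I.supp, ∀ v ∈ I.supp, q v = q m ∨ q v = q m ^ 2 := by
  by_cases h2 : ∃ u ∈ I.supp, ∃ v, u ≠ v ∧ a u v * a v u = 2
  · obtain ⟨u, hu, v, huv, h⟩ := h2
    have := ha.isOfTypeBCF huv h
    rw [SimpleGraph.ConnectedComponent.mem_supp_iff] at hu
    rw [hu] at this
    exact this.exists_eq_or_eq_sq q hq
  · push Not at h2
    obtain ⟨m, rfl⟩ := I.exists_rep
    refine ⟨m, rfl, fun v hv => Or.inl ?_⟩
    have key : ∀ u w, (dynkinGraph a).Walk u w →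
        w ∈ ((dynkinGraph a).connectedComponentMk m).supp → q u = q w := by
      intro u w p hw
      induction p with
      | nil => rfl
      | @cons u v w hadj p ih =>
        rw [← ih hw]
        have hu : u ∈ ((dynkinGraph a).connectedComponentMk m).supp := by
          rw [SimpleGraph.ConnectedComponent.mem_supp_iff] at hw ⊢
          rw [← hw]
          exact SimpleGraph.ConnectedComponent.sound ⟨.cons hadj p⟩
        obtain ⟨hne, h0⟩ := ha.adj_iff.1 hadj
        have h1 := ha.le_neg_one hne h0
        have h3 := ha.le_neg_one hne.symm (ha.symm_ne_zero h0)
        have h4 := ha.mul_le hne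
        have h5 := h2 u hu v hne
        have h6 := hI u hu v hne
        have h7 : a u v * a v u = 1 := by
          have : 1 ≤ a u v * a v u := by nlinarith
          omega
        have h8 : a u v = -1 := by nlinarith
        have h9 : a v u = -1 := by nlinarith
        have := hq u v
        rw [h8, h9] at this
        simpa using this
    exact key v m (SimpleGraph.ConnectedComponent.exact hv).some rfl

end Types

section Braiding

variable {ι : Type*} {a : Matrix ι ι ℤ} {Γ M : Type*} [CommGroup Γ] [CommGroup M]
  {g : ι → Γ} {χ : ι → Γ →* M}

theorem zpow_eq_zpow_of_cartan (hcartan : ∀ i j, χ j (g i) * χ i (g j) = χ i (g i) ^ a i j)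
    (i j : ι) : χ i (g i) ^ a i j = χ j (g j) ^ a j i := by
  rw [← hcartan, ← hcartan, mul_comm]

/-- If `x_l` has the degree of the element `(ad xᵢ)ʳ(xⱼ)`, the Cartan condition for `i` and `l`
becomes a condition on the order of `qᵢ`. -/
theorem zpow_eq_of_degree (hcartan : ∀ i j, χ j (g i) * χ i (g j) = χ i (g i) ^ a i j)
    {i j l : ι} {r : ℕ} (hg : g l = g i ^ r * g j) (hχ : χ l = χ i ^ r * χ j) :
    χ i (g i) ^ (2 * r + a i j - a i l) = 1 := by
  have h := hcartan i l
  rw [hg, hχ] at h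
  simp only [map_mul, map_pow, MonoidHom.mul_apply, MonoidHom.pow_apply] at h
  rw [zpow_sub, ← h, mul_inv_eq_one, zpow_add, ← hcartan i j, two_mul, zpow_add, zpow_natCast]
  exact mul_mul_mul_comm _ _ _ _

/-- The Cartan condition for `j` and `l`, if `x_l` has the degree of `(ad xᵢ)ʳ(xⱼ)`. -/
theorem zpow_mul_zpow_eq_of_degree
    (hcartan : ∀ i j, χ j (g i) * χ i (g j) = χ i (g i) ^ a i j)
    {i j l : ι} {r : ℕ} (hg : g l = g i ^ r * g j) (hχ : χ l = χ i ^ r * χ j) :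
    χ i (g i) ^ (r * a i j) * χ j (g j) ^ (2 : ℤ) = χ j (g j) ^ a j l := by
  have h := hcartan j l
  rw [hg, hχ] at h
  simp only [map_mul, map_pow, MonoidHom.mul_apply, MonoidHom.pow_apply] at h
  rw [← h, mul_comm (r : ℤ), zpow_mul, ← hcartan i j, zpow_natCast, mul_pow, zpow_two,
    mul_comm (χ j (g i) ^ r)]
  exact mul_mul_mul_comm _ _ _ _

variable [Fintype ι] [DecidableEq ι]

/-- The degree of the commutator of `xᵢ` and `xⱼ` for `i ≁ j` is not the degree of a generator. -/
theorem not_degree_of_not_reachable (ha : IsFiniteCartanMatrix a) (hχ : ∀ i, χ i (g i) ≠ 1)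
    (hcartan : ∀ i j, χ j (g i) * χ i (g j) = χ i (g i) ^ a i j)
    (hodd : ∀ i, Odd (orderOf (χ i (g i)))) {i j : ι} (hij : ¬ (dynkinGraph a).Reachable i j)
    (l : ι) (hg : g l = g i * g j) (hl : χ l = χ i * χ j) : False := by
  have hzero : ∀ {i j}, ¬ (dynkinGraph a).Reachable i j → a i j = 0 := by
    intro i j h
    by_contra h0
    refine h (SimpleGraph.Adj.reachable (ha.adj_iff.2 ⟨?_, h0⟩))
    rintro rfl
    exact h (.refl _)
  have key : ∀ {i j l : ι}, a i j = 0 → a i l = 0 → g l = g i * g j → χ l = χ i * χ j → False := by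
    intro i j l h1 h2 hg hl
    have h := zpow_eq_of_degree hcartan (r := 1) (by rwa [pow_one]) (by rwa [pow_one])
    rw [h1, h2] at h
    have := orderOf_eq_natAbs_of_zpow_eq_one (hodd i) (hχ i) h (by norm_num) (by norm_num)
    norm_num at this
  by_cases h : (dynkinGraph a).Reachable i l
  · exact key (hzero fun h' => hij h'.symm) (hzero fun h' => hij (h.trans h'.symm))
      (hg.trans (mul_comm _ _)) (hl.trans (mul_comm _ _))
  · exact key (hzero hij) (hzero h) hg hl

variable {i j : ι}

/-- The degree of `(ad xᵢ)^{1 - aᵢⱼ}(xⱼ)`, for `i ∼ j`, is not the degree of a generator. -/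
theorem not_degree_of_reachable (ha : IsFiniteCartanMatrix a) (hχ : ∀ i, χ i (g i) ≠ 1)
    (hcartan : ∀ i j, χ j (g i) * χ i (g j) = χ i (g i) ^ a i j)
    (hodd : ∀ i, Odd (orderOf (χ i (g i)))) (hij : i ≠ j)
    (hconn : j ∈ ((dynkinGraph a).connectedComponentMk i).supp)
    (h3 : orderOf (χ i (g i)) ≠ 3)
    (h5 : IsOfTypeBCF a ((dynkinGraph a).connectedComponentMk i).supp → orderOf (χ i (g i)) ≠ 5)
    (l : ι) (hg : g l = g i ^ (1 - a i j).toNat * g j)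
    (hl : χ l = χ i ^ (1 - a i j).toNat * χ j) : False := by
  have hneg := ha.nonpos i j hij
  have hr : ((1 - a i j).toNat : ℤ) = 1 - a i j := Int.toNat_of_nonneg (by omega)
  have hi := zpow_eq_of_degree hcartan hg hl
  have hj := zpow_mul_zpow_eq_of_degree hcartan hg hl
  rw [hr] at hi hj
  have hord : ∀ {m : ℤ}, χ i (g i) ^ m = 1 → m ≠ 0 → m.natAbs ≤ 5 →
      m.natAbs = 5 ∧ orderOf (χ i (g i)) = 5 := by
    intro m hm h0 h
    obtain ⟨e1, e2⟩ := orderOf_eq_natAbs_of_zpow_eq_one (hodd i) (hχ i) hm h0 (Or.inl h)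
    omega
  have hlow : ∀ v, i ≠ v → a i v ≠ 0 → -(a i v) ≤ a i v * a v i ∧ 1 ≤ a i v * a v i := by
    intro v hv h0
    have h1 := ha.le_neg_one hv h0
    have h2 := ha.le_neg_one hv.symm (ha.symm_ne_zero h0)
    constructor <;> nlinarith
  have hij3 : -3 ≤ a i j := by
    by_cases h0 : a i j = 0
    · omega
    · have := hlow j hij h0
      have := ha.mul_le hij
      omega
  by_cases hli : i = l
  · subst hli
    by_cases h0 : a i j = 0
    · rw [h0] at hl
      have : χ j = 1 := by simpa using hl
      exact hχ j (by rw [this]; rfl)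
    · rw [ha.diag] at hi
      have := hord hi (by omega) (by omega)
      omega
  by_cases hlj : j = l
  · subst hlj
    have h1 : χ i ^ (1 - a i j).toNat = 1 := by simpa using hl
    have h2 : χ i (g i) ^ (1 - a i j) = 1 := by
      rw [← hr, zpow_natCast, ← MonoidHom.pow_apply, h1]
      rfl
    have := hord h2 (by omega) (by omega)
    omega
  have hil := ha.nonpos i l hli
  have hsum := ha.mul_add_mul_le hij hli hlj
  have hm : χ i (g i) ^ (2 - a i j - a i l) = 1 := by
    rw [← hi]
    congr 1
    ring
  by_cases h0 : a i j = 0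
  · have hb : -3 ≤ a i l := by
      by_cases h0' : a i l = 0
      · omega
      · have := hlow l hli h0'
        rw [h0] at hsum
        omega
    have h5 := hord hm (by omega) (by omega)
    have h6 : a i l = -3 := by omega
    have h7 := hlow l hli (by omega)
    have h8 := (ha.isOfType_G₂ hli (by rw [h0] at hsum; omega)).1
    rw [h8] at hconn
    rcases hconn with h | h
    · exact hij h.symm
    · exact hlj h
  · have h1 := hlow j hij h0
    by_cases h0' : a i l = 0
    · obtain ⟨h6, h7⟩ := hord hm (by omega) (by omega)
      have h8 : a i j = -3 := by omega
      -- here `qⱼ = qᵢ ^ 3`, `qᵢ ^ 5 = 1`, and `l` is not in the component `{i, j}`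
      have h9 : a i j * a j i = 3 := by
        have := ha.mul_le hij
        omega
      have hji : a j i = -1 := by
        rw [h8] at h9
        omega
      have hjl : a j l = 0 := by
        by_contra h10
        have h11 := ha.le_neg_one hlj h10
        have h12 := ha.le_neg_one (Ne.symm hlj) (ha.symm_ne_zero h10)
        have h13 := ha.mul_add_mul_le hij.symm hlj hli
        nlinarith
      have hqj := zpow_eq_zpow_of_cartan hcartan i j
      rw [h8, hji] at hqj
      have hqj' : χ j (g j) = χ i (g i) ^ (3 : ℤ) := by
        rw [← inv_inj, ← zpow_neg_one, ← hqj, zpow_neg]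
      rw [h8, hjl, hqj', ← zpow_mul, ← zpow_add, zpow_zero] at hj
      rw [h8, h0'] at hm
      have h10 : χ i (g i) ^ (1 : ℤ) = 1 := by
        have : (1 : ℤ) = ((1 - -3) * -3 + 3 * 2) * (-1) + (2 - -3 - 0) * (-1) := by norm_num
        rw [this, zpow_add, zpow_mul, zpow_mul, hj, hm, one_zpow, one_mul]
      exact hχ i (by simpa using h10)
    · have h2 := hlow l hli h0'
      obtain ⟨h6, h7⟩ := hord hm (by omega) (by omega)
      refine h5 ?_ h7
      rcases (by omega : a i j * a j i = 2 ∨ a i l * a l i = 2) with h | h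
      · exact ha.isOfTypeBCF hij h
      · exact ha.isOfTypeBCF hli h

/-- The character of `(ad xᵢ)^{1 - aᵢⱼ}(xⱼ)`, for `i ∼ j`, is not trivial. -/
theorem character_ne_one_of_reachable (ha : IsFiniteCartanMatrix a) (hχ : ∀ i, χ i (g i) ≠ 1)
    (hcartan : ∀ i j, χ j (g i) * χ i (g j) = χ i (g i) ^ a i j)
    (hodd : ∀ i, Odd (orderOf (χ i (g i)))) (hij : i ≠ j)
    (hconn : j ∈ ((dynkinGraph a).connectedComponentMk i).supp)
    (h3 : ∀ v ∈ ((dynkinGraph a).connectedComponentMk i).supp, orderOf (χ v (g v)) ≠ 3)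
    (h5 : IsOfTypeBCF a ((dynkinGraph a).connectedComponentMk i).supp → orderOf (χ i (g i)) ≠ 5)
    (h7 : IsOfType a ((dynkinGraph a).connectedComponentMk i).supp CartanMatrix.G₂ →
      orderOf (χ i (g i)) ≠ 7) : χ i ^ (1 - a i j).toNat * χ j ≠ 1 := by
  intro h
  have hneg := ha.nonpos i j hij
  have hr : ((1 - a i j).toNat : ℤ) = 1 - a i j := Int.toNat_of_nonneg (by omega)
  have hgi : χ i (g i) ^ (1 - a i j) * χ j (g i) = 1 := by
    rw [← hr, zpow_natCast]
    exact DFunLike.congr_fun h (g i)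
  have hgj : χ i (g j) ^ (1 - a i j) * χ j (g j) = 1 := by
    rw [← hr, zpow_natCast]
    exact DFunLike.congr_fun h (g j)
  have hji : χ i (g j) = χ i (g i) := by
    have h1 : χ j (g i) = (χ i (g i) ^ (1 - a i j))⁻¹ := eq_inv_of_mul_eq_one_right hgi
    have h2 := hcartan i j
    rw [h1, inv_mul_eq_iff_eq_mul, ← zpow_add] at h2
    simpa using h2
  rw [hji] at hgj
  have hq := zpow_eq_zpow_of_cartan hcartan
  have hqj : χ j (g j) = χ i (g i) ^ (-(1 - a i j)) := by
    rw [zpow_neg]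
    exact eq_inv_of_mul_eq_one_right hgj
  by_cases h0 : a i j = 0
  · obtain ⟨m, hm, hval⟩ := ha.exists_eq_or_eq_sq (fun i => χ i (g i)) hq
      ((dynkinGraph a).connectedComponentMk i) (by
        intro u hu v huv h
        have hs := (ha.isOfType_G₂ huv h).1
        rw [SimpleGraph.ConnectedComponent.mem_supp_iff] at hu
        rw [hu] at hs
        have hi : i ∈ ((dynkinGraph a).connectedComponentMk i).supp := rfl
        rw [hs] at hconn hi
        have h1 : a u v ≠ 0 := fun e => by simp [e] at h
        have h2 : a v u ≠ 0 := fun e => by simp [e] at h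
        simp only [Set.mem_insert_iff, Set.mem_singleton_iff] at hi hconn
        rcases hi with rfl | rfl <;> rcases hconn with rfl | rfl <;> simp_all)
    rw [h0, sub_zero, zpow_one] at hgj
    -- `qᵢqⱼ = 1` becomes `u² = 1`, `u³ = 1` or `u⁴ = 1` for `u = q_m`
    have hfin : ∃ n : ℤ, χ m (g m) ^ n = 1 ∧ 2 ≤ n ∧ n ≤ 4 := by
      have hi := hval i rfl
      have hj := hval j hconn
      rcases hi with hi | hi <;> rcases hj with hj | hj <;> simp only [hi, hj] at hgj
      · exact ⟨2, by rw [zpow_two]; exact hgj, by norm_num⟩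
      · exact ⟨3, by rw [← hgj]; group, by norm_num⟩
      · exact ⟨3, by rw [← hgj]; group, by norm_num⟩
      · exact ⟨4, by rw [← hgj]; group, by norm_num⟩
    obtain ⟨n, hn, hn2, hn4⟩ := hfin
    have := orderOf_eq_natAbs_of_zpow_eq_one (hodd m) (hχ m) hn (by omega) (by omega)
    have := h3 m hm
    omega
  · have h1 := ha.le_neg_one hij h0
    have h2 := ha.le_neg_one hij.symm (ha.symm_ne_zero h0)
    have hle := ha.mul_le hij
    have hpos : 1 ≤ a i j * a j i := by nlinarith
    have hm : χ i (g i) ^ (a i j + (1 - a i j) * a j i) = 1 := by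
      have := hq i j
      rw [hqj, ← zpow_mul] at this
      rw [zpow_add, this, ← zpow_add, neg_mul, neg_add_cancel, zpow_zero]
    have hi3 := h3 i rfl
    obtain hp | hp | hp : a i j * a j i = 1 ∨ a i j * a j i = 2 ∨ a i j * a j i = 3 := by omega
    · have e1 : a i j = -1 := by nlinarith
      have e2 : a j i = -1 := by nlinarith
      rw [e1, e2] at hm
      have := orderOf_eq_natAbs_of_zpow_eq_one (hodd i) (hχ i) hm (by norm_num) (by norm_num)
      exact hi3 this.1
    · have hi5 := h5 (ha.isOfTypeBCF hij hp)
      rcases ha.double_edge hij hp with ⟨e1, e2⟩ | ⟨e1, e2⟩ <;> rw [e1, e2] at hm <;>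
        exact hi5 (orderOf_eq_natAbs_of_zpow_eq_one (hodd i) (hχ i) hm (by norm_num)
          (by norm_num)).1
    · have hi7 := h7 (ha.isOfType_G₂ hij hp).2
      rcases ha.triple_edge hij hp with ⟨e1, e2⟩ | ⟨e1, e2⟩ <;> rw [e1, e2] at hm <;>
        exact hi7 (orderOf_eq_natAbs_of_zpow_eq_one (hodd i) (hχ i) hm (by norm_num)
          (by norm_num)).1

end Braiding

/-! ### The graded coalgebra in degrees zero and one -/

section Graded

variable (k : Type*) {C : Type*} [Field k] [AddCommGroup C] [Module k C] [Coalgebra k C]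

theorem grProj_grMk_zero (c : coradicalFiltration k C 0) : grProj k C (grMk k C 0 c) = ⟨c, coradicalFiltration_zero_le k c.2⟩ := by
  simp only [grProj, grMk, LinearMap.comp_apply, DirectSum.component.lof_self]
  rfl

theorem grProj_grMk_succ (n : ℕ) (c : coradicalFiltration k C (n + 1)) :
    grProj k C (grMk k C (n + 1) c) = 0 := by
  simp only [grProj, grMk, LinearMap.comp_apply]
  rw [DirectSum.component.of, dif_neg (by omega), map_zero]

/-- The components of the comultiplication of `gr C` can be computed in `C/Cₚ₋₁ ⊗ C/C_{q-1}`. -/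
theorem grComulComponent_eq {n p q : ℕ} (h : p + q = n) (x : coradicalFiltration k C n)
    (w : GrPiece k C p ⊗[k] GrPiece k C q)
    (hw : TensorProduct.map (grEmb k p) (grEmb k q) w =
      TensorProduct.map (prevFiltration k C p).mkQ (prevFiltration k C q).mkQ
        (Coalgebra.comul (R := k) (x : C))) :
    grComulComponent k h (Submodule.Quotient.mk x) = w :=
  map_grEmb_injective k p q ((map_grEmb_grComulComponent k h x).trans hw.symm)

theorem grComul_grMk (n : ℕ) (x : coradicalFiltration k C n) :
    grComul k C (grMk k C n x) = ∑ p : Fin (n + 1),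
      TensorProduct.map (DirectSum.lof k ℕ (GrPiece k C) p)
        (DirectSum.lof k ℕ (GrPiece k C) (n - p))
        (grComulComponent k (Nat.add_sub_of_le (Nat.lt_succ_iff.1 p.2))
          (Submodule.Quotient.mk x)) := by
  simp only [grComul, grMk, LinearMap.comp_apply, DirectSum.toModule_lof, LinearMap.sum_apply]
  rfl

theorem grComul_grMk_zero {h : C} (hh : IsGroupLikeElem k h) (h0 : h ∈ coradicalFiltration k C 0) :
    grComul k C (grMk k C 0 ⟨h, h0⟩) = grMk k C 0 ⟨h, h0⟩ ⊗ₜ[k] grMk k C 0 ⟨h, h0⟩ := by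
  rw [grComul_grMk, Fin.sum_univ_one]
  -- the degrees `p` and `n - p` of the components are numerals only up to definitional unfolding
  erw [grComulComponent_eq k (n := 0) (p := 0) (q := 0) rfl ⟨h, h0⟩
    ((Submodule.Quotient.mk ⟨h, h0⟩) ⊗ₜ[k] (Submodule.Quotient.mk ⟨h, h0⟩))]
  · rfl
  · rw [hh.comul_eq_tmul_self]
    rfl

theorem grMk_eq_zero_iff (n : ℕ) (x : coradicalFiltration k C n) :
    grMk k C n x = 0 ↔ (x : C) ∈ prevFiltration k C n := by
  rw [grMk, LinearMap.comp_apply]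
  constructor
  · intro h
    have h1 := DirectSum.of_injective (β := GrPiece k C) n (h.trans (map_zero _).symm)
    simpa using h1
  · intro h
    have : Submodule.mkQ ((prevFiltration k C n).comap (coradicalFiltration k C n).subtype) x = 0 :=
      (Submodule.Quotient.mk_eq_zero _).2 h
    rw [this, map_zero]

end Graded

section Bialgebra

variable (k : Type*) {A : Type*} [Field k] [Ring A] [HopfAlgebra k A]

/-- A linear form which is `1` at a group-like element `h` and vanishes at the other ones. -/
theorem exists_dual_groupLike {h : A} (hh : IsGroupLikeElem k h) :
    ∃ f : A →ₗ[k] k, f h = 1 ∧ ∀ g, IsGroupLikeElem k g → g ≠ h → f g = 0 := by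
  have hli := linearIndep_groupLikeVal (R := k) (A := A)
  obtain ⟨f, hf⟩ := LinearMap.exists_extend (Finsupp.lapply (⟨h, hh⟩ : GroupLike k A) ∘ₗ hli.repr)
  have key : ∀ g : GroupLike k A, f g = Finsupp.single g 1 ⟨h, hh⟩ := by
    intro g
    rw [← hli.repr_eq_single g ⟨g, Submodule.subset_span ⟨g, rfl⟩⟩ rfl]
    exact LinearMap.congr_fun hf ⟨g, Submodule.subset_span ⟨g, rfl⟩⟩
  refine ⟨f, (key ⟨h, hh⟩).trans Finsupp.single_eq_same, fun g hg hne => ?_⟩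
  exact (key ⟨g, hg⟩).trans (Finsupp.single_eq_of_ne fun e => hne (congrArg GroupLike.val e).symm)

variable [IsPointed k A]

theorem mem_coradicalFiltration_one {h z : A} (hh : IsGroupLikeElem k h)
    (hz : IsSkewPrimitive k h 1 z) : z ∈ coradicalFiltration k A 1 := by
  change _ ∈ wedge k _ _
  rw [wedge, Submodule.mem_comap, hz]
  refine add_mem (Submodule.mem_sup_right ?_) (Submodule.mem_sup_left ?_)
  · exact ⟨z ⊗ₜ[k] ⟨1, groupLike_mem_coradical k .one⟩, rfl⟩
  · exact ⟨⟨h, groupLike_mem_coradical k hh⟩ ⊗ₜ[k] z, rfl⟩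

theorem groupLike_mem_coradicalFiltration_zero {h : A} (hh : IsGroupLikeElem k h) :
    h ∈ coradicalFiltration k A 0 :=
  groupLike_mem_coradical k hh

/-- In `gr A` the class `z̄` in degree one of a skew-primitive element `z` has
`Δ(z̄) = z̄ ⊗ 1 + h ⊗ z̄`. -/
theorem grComul_grMk_one {h z : A} (hh : IsGroupLikeElem k h) (hz : IsSkewPrimitive k h 1 z)
    (hz1 : z ∈ coradicalFiltration k A 1) :
    grComul k A (grMk k A 1 ⟨z, hz1⟩) = grMk k A 1 ⟨z, hz1⟩ ⊗ₜ[k] grOne k A +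
      grMk k A 0 ⟨h, groupLike_mem_coradicalFiltration_zero k hh⟩ ⊗ₜ[k] grMk k A 1 ⟨z, hz1⟩ := by
  have hh0 := groupLike_mem_coradical k hh
  have hone : (1 : A) ∈ coradicalFiltration k A 0 := groupLike_mem_coradical k .one
  rw [grComul_grMk, Fin.sum_univ_two]
  erw [grComulComponent_eq k (n := 1) (p := 0) (q := 1) rfl ⟨z, hz1⟩
      ((Submodule.Quotient.mk ⟨h, hh0⟩) ⊗ₜ[k] (Submodule.Quotient.mk ⟨z, hz1⟩)),
    grComulComponent_eq k (n := 1) (p := 1) (q := 0) rfl ⟨z, hz1⟩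
      ((Submodule.Quotient.mk ⟨z, hz1⟩) ⊗ₜ[k] (Submodule.Quotient.mk ⟨1, hone⟩))]
  · rw [add_comm]
    rfl
  · have h0 : (prevFiltration k A 1).mkQ h = 0 := (Submodule.Quotient.mk_eq_zero _).2 hh0
    rw [hz, map_add, TensorProduct.map_tmul, TensorProduct.map_tmul, TensorProduct.map_tmul, h0,
      TensorProduct.zero_tmul, add_zero]
    rfl
  · have h0 : (prevFiltration k A 1).mkQ (1 : A) = 0 := (Submodule.Quotient.mk_eq_zero _).2 hone
    rw [hz, map_add, TensorProduct.map_tmul, TensorProduct.map_tmul, TensorProduct.map_tmul, h0,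
      TensorProduct.tmul_zero, zero_add]
    rfl

theorem grCoaction_grMk_one {h z : A} (hh : IsGroupLikeElem k h) (hz : IsSkewPrimitive k h 1 z)
    (hz1 : z ∈ coradicalFiltration k A 1) : grCoaction k A (grMk k A 1 ⟨z, hz1⟩) =
      (⟨h, groupLike_mem_coradical k hh⟩ : coradical k A) ⊗ₜ[k] grMk k A 1 ⟨z, hz1⟩ := by
  rw [grCoaction, LinearMap.comp_apply, grComul_grMk_one k hh hz hz1, map_add,
    LinearMap.rTensor_tmul, LinearMap.rTensor_tmul, grProj_grMk_zero, grProj_grMk_succ,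
    TensorProduct.zero_tmul, zero_add]

/-- The class in `A₁/A₀` of a skew-primitive element is a primitive element of the diagram. -/
theorem grMk_mem_diagramPrimitives {h z : A} (hh : IsGroupLikeElem k h)
    (hz : IsSkewPrimitive k h 1 z) (hz1 : z ∈ coradicalFiltration k A 1) :
    grMk k A 1 ⟨z, hz1⟩ ∈ diagramPrimitives k A := by
  have hΔ := grComul_grMk_one k hh hz hz1
  have hproj : grProj k A (grMk k A 1 ⟨z, hz1⟩) = 0 := grProj_grMk_succ k 0 _
  have hone : grProj k A (grOne k A) = coradicalOne k A := grProj_grMk_zero k _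
  constructor
  · change LinearMap.lTensor _ _ (grComul k A _) = grMk k A 1 ⟨z, hz1⟩ ⊗ₜ[k] coradicalOne k A
    rw [hΔ, map_add, LinearMap.lTensor_tmul, LinearMap.lTensor_tmul, hproj, hone,
      TensorProduct.tmul_zero, add_zero]
  · change LinearMap.rTensor _ _ (LinearMap.rTensor _ _ (grComul k A _)) =
      grMk k A 1 ⟨z, hz1⟩ ⊗ₜ[k] grOne k A + grOne k A ⊗ₜ[k] grMk k A 1 ⟨z, hz1⟩
    have e1 : grMulAntipode k A (grMk k A 1 ⟨z, hz1⟩ ⊗ₜ[k] grOne k A) = grMk k A 1 ⟨z, hz1⟩ := by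
      change grMulRight k A (LinearMap.restrict _
        (fun _ hc => antipode_mem_coradical k hc) (grProj k A (grOne k A))) _ = _
      rw [hone]
      simp only [grMulRight, grMap, grMk, LinearMap.comp_apply, LinearMap.coe_mk, AddHom.coe_mk,
        DirectSum.lmap_lof, Submodule.mkQ_apply, Submodule.mapQ_apply]
      congr 2
      refine Subtype.ext ?_
      change z * HopfAlgebra.antipode k (1 : A) = z
      rw [HopfAlgebra.antipode_one, mul_one]
    have e2 : ∀ c, grMulAntipode k A (c ⊗ₜ[k] grMk k A 1 ⟨z, hz1⟩) = 0 := by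
      intro c
      change grMulRight k A (LinearMap.restrict _
        (fun _ hc => antipode_mem_coradical k hc) (grProj k A _)) _ = _
      rw [hproj, map_zero, map_zero]
      rfl
    have e3 : grMulAntipode k A (grMk k A 0 ⟨h, groupLike_mem_coradicalFiltration_zero k hh⟩ ⊗ₜ[k]
        grMk k A 0 ⟨h, groupLike_mem_coradicalFiltration_zero k hh⟩) = grOne k A := by
      change grMulRight k A (LinearMap.restrict _
        (fun _ hc => antipode_mem_coradical k hc) (grProj k A _)) _ = _
      rw [grProj_grMk_zero]
      simp only [grMulRight, grMap, grMk, grOne, LinearMap.comp_apply, LinearMap.coe_mk,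
        AddHom.coe_mk, DirectSum.lmap_lof, Submodule.mkQ_apply, Submodule.mapQ_apply]
      refine congrArg (fun c => DirectSum.lof k ℕ (GrPiece k A) 0 (Submodule.Quotient.mk c))
        (Subtype.ext ?_)
      change h * HopfAlgebra.antipode k h = 1
      exact hh.mul_antipode_cancel
    rw [hΔ, map_add, LinearMap.rTensor_tmul, LinearMap.rTensor_tmul, hΔ,
      grComul_grMk_zero k hh, map_add, LinearMap.rTensor_tmul, LinearMap.rTensor_tmul, map_add,
      e1, e2, e3, add_zero]

/-- A skew-primitive element of the coradical of a pointed Hopf algebra is a multiple of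
`1 - h`. -/
theorem IsSkewPrimitive.exists_eq_smul {h z : A} (hh : IsGroupLikeElem k h)
    (hz : IsSkewPrimitive k h 1 z) (hz0 : z ∈ coradical k A) : ∃ c : k, z = c • (1 - h) := by
  obtain ⟨f, hfh, hf⟩ := exists_dual_groupLike k hh
  have key : ∀ x ∈ coradical k A,
      TensorProduct.lid k A (f.rTensor A (Coalgebra.comul (R := k) x)) = f x • h := by
    intro x hx
    rw [IsPointed.coradical_eq] at hx
    induction hx using Submodule.span_induction with
    | mem x hx =>
      rw [IsGroupLikeElem.comul_eq_tmul_self hx, LinearMap.rTensor_tmul, TensorProduct.lid_tmul]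
      by_cases e : x = h
      · rw [e]
      · rw [hf x hx e, zero_smul, zero_smul]
    | zero => simp
    | add x y _ _ hx hy => simp only [map_add, hx, hy, add_smul]
    | smul c x _ hx => simp only [map_smul, hx, smul_assoc]
  have h1 := key z hz0
  rw [hz, map_add, LinearMap.rTensor_tmul, LinearMap.rTensor_tmul, map_add, TensorProduct.lid_tmul,
    TensorProduct.lid_tmul, hfh, one_smul] at h1
  refine ⟨- f z, ?_⟩
  rw [smul_sub, neg_smul, neg_smul, sub_neg_eq_add, ← h1]
  abel

end Bialgebra

/-! ### Skew-primitive elements and the infinitesimal braiding -/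

section YetterDrinfeld

/-- The coefficients of an eigenvector of a diagonal map vanish outside its eigenvalue. -/
theorem _root_.Module.Basis.eigenvalue_eq_of_repr_ne_zero {k V ι : Type*} [Field k]
    [AddCommGroup V] [Module k V] (x : Module.Basis ι k V) {L : V →ₗ[k] V} {μ : ι → k}
    (hL : ∀ l, L (x l) = μ l • x l) {v : V} {c : k} (hv : L v = c • v) {l : ι}
    (hl : x.repr v l ≠ 0) : μ l = c := by
  have key : x.coord l ∘ₗ L = μ l • x.coord l := by
    refine x.ext fun m => ?_
    simp only [LinearMap.comp_apply, hL, map_smul, LinearMap.smul_apply, Module.Basis.coord_apply,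
      Module.Basis.repr_self, smul_eq_mul]
    by_cases h : m = l
    · rw [h]
    · rw [Finsupp.single_eq_of_ne (Ne.symm h), mul_zero, mul_zero]
  have h1 := LinearMap.congr_fun key v
  simp only [LinearMap.comp_apply, hv, map_smul, LinearMap.smul_apply, Module.Basis.coord_apply,
    smul_eq_mul] at h1
  exact (mul_right_cancel₀ hl h1).symm

variable {k : Type*} [Field k] {Γ : Type*} [CommGroup Γ] {V : Type*} [AddCommGroup V] [Module k V]
  {A : Type*} [Ring A] [HopfAlgebra k A] [IsPointed k A]

theorem groupAlgebraToCoradical_of (e : Γ ≃* GroupLike k A) (γ : Γ) :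
    (groupAlgebraToCoradical e (MonoidAlgebra.of k Γ γ) : A) = e γ := by
  simp [groupAlgebraToCoradical]

/-- A skew-primitive element `z` outside the coradical, on which the group acts by a character,
gives a primitive element of the diagram; hence its degree is the degree of some basis element of
the infinitesimal braiding. -/
theorem IsSkewPrimitive.mem_coradical_or_exists_degree {ι : Type*} {g : ι → Γ} {χ : ι → Γ →* kˣ}
    (Y : YetterDrinfeld k Γ V) (x : Module.Basis ι k V) (hx : ∀ i, Y.IsHomogeneous (g i) (χ i) (x i))
    (e : Γ ≃* GroupLike k A) (φ : V ≃ₗ[k] diagramPrimitives k A) (hφ : IsYetterDrinfeldIso e Y φ)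
    {γ : Γ} {ψ : Γ →* kˣ} {z : A} (hz : IsSkewPrimitive k (e γ : A) 1 z)
    (hψ : ∀ h, (e h : A) * z * (e h⁻¹ : A) = (ψ h : k) • z) :
    z ∈ coradical k A ∨ ∃ l, g l = γ ∧ χ l = ψ := by
  refine or_iff_not_imp_left.2 fun hz0 => ?_
  have hh := (e γ).2
  have hz1 := mem_coradicalFiltration_one k hh hz
  let w : diagramPrimitives k A := ⟨_, grMk_mem_diagramPrimitives k hh hz hz1⟩
  have hw : (w : Gr k A) = grMk k A 1 ⟨z, hz1⟩ := rfl
  obtain ⟨v, hv⟩ := φ.surjective w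
  have hv0 : v ≠ 0 := by
    rintro rfl
    rw [map_zero] at hv
    have h1 : grMk k A 1 ⟨z, hz1⟩ = 0 := by rw [← hw, ← hv]; rfl
    exact hz0 ((grMk_eq_zero_iff k 1 _).1 h1)
  obtain ⟨l, hl⟩ : ∃ l, x.repr v l ≠ 0 := by
    by_contra! h
    exact hv0 (x.repr.map_eq_zero_iff.1 (Finsupp.ext h))
  refine ⟨l, ?_, ?_⟩
  · -- project the coaction to the component of degree `γ`, where the basis is an eigenbasis
    obtain ⟨f, hf1, hf0⟩ := exists_dual_groupLike k hh
    let f' : coradical k A →ₗ[k] k := f ∘ₗ (coradical k A).subtype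
    let L : V →ₗ[k] V := (TensorProduct.lid k V).toLinearMap ∘ₗ
      (f' ∘ₗ groupAlgebraToCoradical e).rTensor V ∘ₗ Y.coaction
    have hL : ∀ l, L (x l) = f (e (g l)) • x l := by
      intro l
      simp only [L, LinearMap.comp_apply, (hx l).2, LinearMap.rTensor_tmul, LinearEquiv.coe_coe,
        TensorProduct.lid_tmul, f', Submodule.subtype_apply, groupAlgebraToCoradical_of]
    have hLv : L v = (1 : k) • v := by
      rw [one_smul]
      apply φ.injective
      apply Subtype.ext
      have h1 : (diagramPrimitives k A).subtype ∘ₗ φ.toLinearMap ∘ₗ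
          (TensorProduct.lid k V).toLinearMap ∘ₗ (f' ∘ₗ groupAlgebraToCoradical e).rTensor V =
          (TensorProduct.lid k (Gr k A)).toLinearMap ∘ₗ f'.rTensor (Gr k A) ∘ₗ
            TensorProduct.map (groupAlgebraToCoradical e)
              ((diagramPrimitives k A).subtype ∘ₗ φ.toLinearMap) := by
        refine TensorProduct.ext' fun a b => ?_
        simp
      have h2 := LinearMap.congr_fun h1 (Y.coaction v)
      simp only [LinearMap.comp_apply, LinearEquiv.coe_coe, Submodule.subtype_apply] at h2
      simp only [L, LinearMap.comp_apply, LinearEquiv.coe_coe]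
      rw [h2]
      have h3 := hφ.2 v
      rw [← h3, hv, hw, grCoaction_grMk_one k hh hz hz1, LinearMap.rTensor_tmul,
        TensorProduct.lid_tmul]
      change f (e γ) • _ = _
      rw [hf1, one_smul]
    have h1 := x.eigenvalue_eq_of_repr_ne_zero hL hLv hl
    by_contra hne
    rw [hf0 _ (e (g l)).2 fun h => hne (e.injective (GroupLike.val_inj.1 h))] at h1
    exact zero_ne_one h1
  · ext h
    refine x.eigenvalue_eq_of_repr_ne_zero (fun l => (hx l).1 h) ?_ hl
    apply φ.injective
    apply Subtype.ext
    rw [hφ.1, hv, hw, map_smul, hv, Submodule.coe_smul, hw]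
    simp only [grAdjoint, grMap, grMk, LinearMap.comp_apply, DirectSum.lmap_lof,
      Submodule.mkQ_apply, Submodule.mapQ_apply, ← map_smul, ← Submodule.Quotient.mk_smul]
    refine congrArg (fun c => DirectSum.lof k ℕ (GrPiece k A) 1 (Submodule.Quotient.mk c))
        (Subtype.ext ?_)
    change (e h : A) * (z * HopfAlgebra.antipode k (e h : A)) = (ψ h : k) • z
    rw [← hψ h, ← mul_assoc, map_inv, GroupLike.val_inv]

/-- A skew-primitive element on which the group acts by a character, and whose degree is not a
degree of the infinitesimal braiding, is a multiple of `1 - γ`, and vanishes unless the character is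
trivial. -/
theorem IsSkewPrimitive.exists_eq_smul_of_degree {ι : Type*} {g : ι → Γ} {χ : ι → Γ →* kˣ}
    (Y : YetterDrinfeld k Γ V) (x : Module.Basis ι k V) (hx : ∀ i, Y.IsHomogeneous (g i) (χ i) (x i))
    (e : Γ ≃* GroupLike k A) (φ : V ≃ₗ[k] diagramPrimitives k A) (hφ : IsYetterDrinfeldIso e Y φ)
    {γ : Γ} {ψ : Γ →* kˣ} {z : A} (hz : IsSkewPrimitive k (e γ : A) 1 z)
    (hψ : ∀ h, (e h : A) * z * (e h⁻¹ : A) = (ψ h : k) • z)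
    (hdeg : ∀ l, g l = γ → χ l = ψ → False) :
    (∃ c : k, z = c • (1 - (e γ : A))) ∧ (ψ ≠ 1 → z = 0) := by
  obtain hz0 | ⟨l, h1, h2⟩ := hz.mem_coradical_or_exists_degree Y x hx e φ hφ hψ
  · obtain ⟨c, hc⟩ := hz.exists_eq_smul k (e γ).2 hz0
    refine ⟨⟨c, hc⟩, fun hne => ?_⟩
    by_contra hz'
    refine hne ?_
    ext h
    have h1 : (e h : A) * z * (e h⁻¹ : A) = z := by
      have h2 : (e h : A) * (e h⁻¹ : A) = 1 := by
        rw [← GroupLike.val_mul, ← map_mul, mul_inv_cancel, map_one, GroupLike.val_one]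
      have h3 : (e h : A) * (e γ : A) * (e h⁻¹ : A) = e γ := by
        rw [← GroupLike.val_mul, ← GroupLike.val_mul, ← map_mul, ← map_mul, mul_inv_cancel_comm]
      rw [hc, mul_smul_comm, smul_mul_assoc, mul_sub, sub_mul, mul_one, h2, h3]
    rw [hψ h] at h1
    have h2 : ((ψ h : k) - 1) • z = 0 := by rw [sub_smul, h1, one_smul, sub_self]
    exact sub_eq_zero.1 ((smul_eq_zero.1 h2).resolve_right hz')
  · exact (hdeg l h1 h2).elim

end YetterDrinfeld

/-! ### Iterated braided commutators -/

section QBinomial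

variable {k : Type*} [Field k]

/-- The Gaussian binomial coefficient, defined by the `q`-Pascal rule. -/
def qBinomial (q : k) : ℕ → ℕ → k
  | _, 0 => 1
  | 0, _ + 1 => 0
  | n + 1, m + 1 => q ^ (n - m) * qBinomial q n m + qBinomial q n (m + 1)

theorem qBinomial_zero_right (q : k) (n : ℕ) : qBinomial q n 0 = 1 := by
  cases n <;> rfl

theorem qBinomial_succ_succ (q : k) (n m : ℕ) :
    qBinomial q (n + 1) (m + 1) = q ^ (n - m) * qBinomial q n m + qBinomial q n (m + 1) := rfl

theorem qBinomial_eq_zero (q : k) {n m : ℕ} (h : n < m) : qBinomial q n m = 0 := by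
  induction n generalizing m with
  | zero =>
    obtain ⟨m, rfl⟩ : ∃ m', m = m' + 1 := ⟨m - 1, by omega⟩
    rfl
  | succ n ih =>
    obtain ⟨m, rfl⟩ : ∃ m', m = m' + 1 := ⟨m - 1, by omega⟩
    rw [qBinomial_succ_succ, ih (by omega), ih (by omega), mul_zero, add_zero]

theorem qBinomial_self (q : k) (n : ℕ) : qBinomial q n n = 1 := by
  induction n with
  | zero => rfl
  | succ n ih =>
    rw [qBinomial_succ_succ, ih, qBinomial_eq_zero q (Nat.lt_succ_self n), Nat.sub_self, pow_zero,
      one_mul, add_zero]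

/-- The second `q`-Pascal rule. -/
theorem qBinomial_succ_succ' (q : k) (n m : ℕ) :
    qBinomial q (n + 1) (m + 1) = qBinomial q n m + q ^ (m + 1) * qBinomial q n (m + 1) := by
  induction n generalizing m with
  | zero =>
    cases m with
    | zero => simp [qBinomial]
    | succ m => simp [qBinomial]
  | succ n ih =>
    cases m with
    | zero =>
      have h1 := ih 0
      rw [qBinomial_succ_succ q n 0, qBinomial_zero_right] at h1
      rw [qBinomial_succ_succ q (n + 1) 0, qBinomial_succ_succ q n 0, qBinomial_zero_right,
        qBinomial_zero_right]
      simp only [Nat.sub_zero, zero_add, pow_one] at h1 ⊢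
      linear_combination h1
    | succ m =>
      have h1 := ih m
      have h2 := ih (m + 1)
      have h3 := qBinomial_succ_succ q n m
      have h4 := qBinomial_succ_succ q n (m + 1)
      have h5 : q ^ (n - m) * q ^ (m + 1) * qBinomial q n (m + 1) =
          q ^ (m + 2) * q ^ (n - (m + 1)) * qBinomial q n (m + 1) := by
        rcases Nat.lt_or_ge m n with h | h
        · rw [← pow_add, ← pow_add]
          congr 2
          omega
        · rw [qBinomial_eq_zero q (by omega), mul_zero, mul_zero]
      rw [qBinomial_succ_succ q (n + 1) (m + 1), Nat.add_sub_add_right]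
      linear_combination q ^ (n - m) * h1 + h2 - h3 - q ^ (m + 2) * h4 + h5

/-- The coefficients of `Δ((ad y)ⁿ(y'))`, see `comul_adSeq`; here `t` is the product of the two
scalars by which the degrees of `y` and `y'` act on each other. -/
def adCoeff (q t : k) (n m : ℕ) : k := qBinomial q n m * ∏ l ∈ Finset.Ico m n, (1 - q ^ l * t)

theorem adCoeff_self (q t : k) (n : ℕ) : adCoeff q t n n = 1 := by
  rw [adCoeff, qBinomial_self, Finset.Ico_self, Finset.prod_empty, one_mul]

theorem adCoeff_eq_zero (q t : k) {n m : ℕ} (h : n < m) : adCoeff q t n m = 0 := by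
  rw [adCoeff, qBinomial_eq_zero q h, zero_mul]

theorem adCoeff_succ_zero (q t : k) (n : ℕ) :
    adCoeff q t (n + 1) 0 = (1 - q ^ n * t) * adCoeff q t n 0 := by
  rw [adCoeff, adCoeff, qBinomial_zero_right, qBinomial_zero_right,
    Finset.prod_Ico_succ_top (Nat.zero_le n)]
  ring

theorem adCoeff_succ_succ (q t : k) {n m : ℕ} (h : m ≤ n) :
    adCoeff q t (n + 1) (m + 1) =
      (1 - q ^ (n + (m + 1)) * t) * adCoeff q t n (m + 1) + q ^ (n - m) * adCoeff q t n m := by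
  rcases Nat.lt_or_eq_of_le h with h | rfl
  · rw [adCoeff, adCoeff, adCoeff, Finset.prod_Ico_succ_top (by omega),
      Finset.prod_eq_prod_Ico_succ_bot h]
    have h1 := qBinomial_succ_succ q n m
    have h2 := qBinomial_succ_succ' q n m
    have h3 : q ^ (n - m) * q ^ m = q ^ n := by rw [← pow_add, Nat.sub_add_cancel h.le]
    rw [pow_add q n (m + 1)]
    linear_combination (∏ l ∈ Finset.Ico (m + 1) n, (1 - q ^ l * t)) *
      (h1 - q ^ n * t * h2 + t * qBinomial q n m * h3)
  · rw [adCoeff_self, adCoeff_self, adCoeff_eq_zero q t (Nat.lt_succ_self m), Nat.sub_self,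
      pow_zero, mul_zero, zero_add, one_mul]

/-- The lower coefficients vanish if `qⁿ t = 1`. -/
theorem adCoeff_succ_eq_zero {q t : k} {n m : ℕ} (h : q ^ n * t = 1) (hm : m ≤ n) :
    adCoeff q t (n + 1) m = 0 := by
  rw [adCoeff, Finset.prod_eq_zero (Finset.mem_Ico.2 ⟨hm, Nat.lt_succ_self n⟩) (by rw [h, sub_self]),
    mul_zero]

end QBinomial

section Adjoint

variable (k : Type*) {A : Type*} [Field k] [Ring A] [HopfAlgebra k A]

/-- For a skew-primitive `y` one has `ε(y) = 0` and `S(y) = -g⁻¹ y`, so that `ad y` is the braided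
commutator with `y`. -/
theorem ad_apply_of_isSkewPrimitive {g y : A} (hg : IsGroupLikeElem k g)
    (hy : IsSkewPrimitive k g 1 y) (u : A) :
    ad k y u = y * u - g * u * HopfAlgebra.antipode k g * y := by
  have hε : algebraMap k A (Coalgebra.counit (R := k) y) = 0 := by
    have h := congrArg (TensorProduct.lid k A) (Coalgebra.rTensor_counit_comul (R := k) y)
    rw [hy, map_add, LinearMap.rTensor_tmul, LinearMap.rTensor_tmul, hg.counit_eq_one, map_add,
      TensorProduct.lid_tmul, TensorProduct.lid_tmul] at h
    rw [one_smul, add_eq_right] at h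
    rw [Algebra.algebraMap_eq_smul_one, h]
  have hS : HopfAlgebra.antipode k y = -(HopfAlgebra.antipode k g * y) := by
    have h := HopfAlgebra.mul_antipode_rTensor_comul_apply (R := k) y
    rw [hy, map_add, LinearMap.rTensor_tmul, LinearMap.rTensor_tmul, map_add, LinearMap.mul'_apply,
      LinearMap.mul'_apply, mul_one, hε] at h
    exact eq_neg_of_add_eq_zero_left h
  have h1 : ad k y = LinearMap.mulLeft k y ∘ₗ LinearMap.mulRight k (HopfAlgebra.antipode k (1 : A)) +
      LinearMap.mulLeft k g ∘ₗ LinearMap.mulRight k (HopfAlgebra.antipode k y) := by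
    rw [ad, LinearMap.comp_apply, hy, map_add]
    rfl
  rw [h1, HopfAlgebra.antipode_one, hS]
  simp only [LinearMap.add_apply, LinearMap.comp_apply, LinearMap.mulRight_apply,
    LinearMap.mulLeft_apply]
  noncomm_ring

variable {k} {g h y y' : A} {q p p' : k}

/-- The elements `uₙ = (ad y)ⁿ(y')`, given by iterated braided commutators. -/
def adSeq (y y' : A) (q p : k) : ℕ → A
  | 0 => y'
  | n + 1 => y * adSeq y y' q p n - (q ^ n * p) • (adSeq y y' q p n * y)

theorem adSeq_succ (y y' : A) (q p : k) (n : ℕ) : adSeq y y' q p (n + 1) =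
    y * adSeq y y' q p n - (q ^ n * p) • (adSeq y y' q p n * y) := rfl

/-- If `c` commutes with `y` and `y'` up to scalars, then also with the iterated commutators. -/
theorem mul_adSeq {c : A} {r s : k} (hy : c * y = r • (y * c)) (hy' : c * y' = s • (y' * c))
    (n : ℕ) : c * adSeq y y' q p n = (r ^ n * s) • (adSeq y y' q p n * c) := by
  induction n with
  | zero => rw [pow_zero, one_mul]; exact hy'
  | succ n ih =>
    have h1 : c * (y * adSeq y y' q p n) = (r ^ (n + 1) * s) • (y * adSeq y y' q p n * c) := by
      rw [← mul_assoc, hy, smul_mul_assoc, mul_assoc, ih, mul_smul_comm, smul_smul, mul_assoc]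
      congr 1
      ring
    have h2 : c * (adSeq y y' q p n * y) = (r ^ (n + 1) * s) • (adSeq y y' q p n * y * c) := by
      rw [← mul_assoc, ih, smul_mul_assoc, mul_assoc, hy, mul_smul_comm, smul_smul, ← mul_assoc]
      congr 1
      ring
    rw [adSeq_succ, mul_sub, mul_smul_comm, h1, h2, sub_mul, smul_sub, smul_mul_assoc,
      smul_comm (q ^ n * p)]

theorem ad_pow_eq_adSeq (hg : IsGroupLikeElem k g) (hy : IsSkewPrimitive k g 1 y)
    (hgy : g * y = q • (y * g)) (hgy' : g * y' = p • (y' * g)) (n : ℕ) :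
    (ad k y ^ n) y' = adSeq y y' q p n := by
  induction n with
  | zero => rfl
  | succ n ih =>
    rw [pow_succ', Module.End.mul_apply, ih, ad_apply_of_isSkewPrimitive k hg hy,
      mul_adSeq hgy hgy', smul_mul_assoc, mul_assoc _ g, hg.mul_antipode_cancel, mul_one,
      smul_mul_assoc, adSeq_succ]

theorem pow_mul_eq_smul {c y : A} {r : k} (hc : c * y = r • (y * c)) (n : ℕ) :
    c ^ n * y = r ^ n • (y * c ^ n) := by
  induction n with
  | zero => simp
  | succ n ih =>
    rw [pow_succ, mul_assoc, hc, mul_smul_comm, ← mul_assoc, ih, smul_mul_assoc, smul_smul,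
      mul_assoc, mul_comm r, pow_succ]

theorem mul_pow_eq_smul {c y : A} {r : k} (hc : c * y = r • (y * c)) (n : ℕ) :
    c * y ^ n = r ^ n • (y ^ n * c) := by
  induction n with
  | zero => simp
  | succ n ih =>
    rw [pow_succ, ← mul_assoc, ih, smul_mul_assoc, mul_assoc, hc, mul_smul_comm, smul_smul,
      mul_assoc, pow_succ]

/-- The comultiplication of `(ad y)ⁿ(y')` for skew-primitive elements `y` and `y'`, on which
group-like elements act by scalars. -/
theorem comul_adSeq (hy : IsSkewPrimitive k g 1 y) (hy' : IsSkewPrimitive k h 1 y')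
    (hgh : g * h = h * g) (hgy : g * y = q • (y * g)) (hgy' : g * y' = p • (y' * g))
    (hhy : h * y = p' • (y * h)) (n : ℕ) :
    Coalgebra.comul (R := k) (adSeq y y' q p n) = adSeq y y' q p n ⊗ₜ[k] 1 +
      ∑ m ∈ Finset.range (n + 1), adCoeff q (p * p') n m •
        ((y ^ (n - m) * (g ^ m * h)) ⊗ₜ[k] adSeq y y' q p m) := by
  induction n with
  | zero =>
    rw [Finset.sum_range_one, adCoeff_self, one_smul]
    rw [IsSkewPrimitive] at hy'
    simpa [adSeq] using hy'
  | succ n ih =>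
    -- the braided commutator of `Δ(y)` with `uₙ ⊗ 1`
    have e1 : Coalgebra.comul (R := k) y * (adSeq y y' q p n ⊗ₜ[k] 1) -
        (q ^ n * p) • ((adSeq y y' q p n ⊗ₜ[k] 1) * Coalgebra.comul (R := k) y) =
        adSeq y y' q p (n + 1) ⊗ₜ[k] 1 := by
      rw [hy, add_mul, mul_add]
      simp only [Algebra.TensorProduct.tmul_mul_tmul, one_mul, mul_one]
      rw [mul_adSeq hgy hgy', adSeq_succ, TensorProduct.sub_tmul, smul_add]
      simp only [TensorProduct.smul_tmul']
      abel
    -- the braided commutator of `Δ(y)` with the other terms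
    have e2 : ∀ m ≤ n, Coalgebra.comul (R := k) y *
          ((y ^ (n - m) * (g ^ m * h)) ⊗ₜ[k] adSeq y y' q p m) -
        (q ^ n * p) • (((y ^ (n - m) * (g ^ m * h)) ⊗ₜ[k] adSeq y y' q p m) *
          Coalgebra.comul (R := k) y) =
        (1 - q ^ (n + m) * (p * p')) • ((y ^ (n + 1 - m) * (g ^ m * h)) ⊗ₜ[k] adSeq y y' q p m) +
        q ^ (n - m) • ((y ^ (n - m) * (g ^ (m + 1) * h)) ⊗ₜ[k] adSeq y y' q p (m + 1)) := by
      intro m hm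
      have c1 : y * (y ^ (n - m) * (g ^ m * h)) = y ^ (n + 1 - m) * (g ^ m * h) := by
        rw [← mul_assoc, ← pow_succ', Nat.sub_add_comm hm]
      have c2 : g * (y ^ (n - m) * (g ^ m * h)) =
          q ^ (n - m) • (y ^ (n - m) * (g ^ (m + 1) * h)) := by
        rw [← mul_assoc, mul_pow_eq_smul hgy, smul_mul_assoc, mul_assoc, ← mul_assoc g, pow_succ']
      have c3 : y ^ (n - m) * (g ^ m * h) * y =
          (q ^ m * p') • (y ^ (n + 1 - m) * (g ^ m * h)) := by
        rw [mul_assoc, mul_assoc, hhy, mul_smul_comm, ← mul_assoc (g ^ m), pow_mul_eq_smul hgy,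
          smul_mul_assoc, smul_smul, mul_smul_comm, mul_comm p', Nat.sub_add_comm hm, pow_succ]
        simp only [mul_assoc]
      have c4 : y ^ (n - m) * (g ^ m * h) * g = y ^ (n - m) * (g ^ (m + 1) * h) := by
        rw [mul_assoc, mul_assoc, ← hgh, ← mul_assoc (g ^ m), ← pow_succ]
      rw [hy, add_mul, mul_add]
      simp only [Algebra.TensorProduct.tmul_mul_tmul, one_mul, mul_one]
      rw [c1, c2, c3, c4, adSeq_succ, TensorProduct.tmul_sub]
      simp only [← TensorProduct.smul_tmul', TensorProduct.tmul_smul, smul_add, smul_sub, sub_smul,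
        smul_smul, one_smul]
      have h1 : q ^ n * p * (q ^ m * p') = q ^ (n + m) * (p * p') := by ring
      have h2 : q ^ (n - m) * (q ^ m * p) = q ^ n * p := by
        rw [← mul_assoc, ← pow_add, Nat.sub_add_cancel hm]
      rw [h1, h2]
      abel
    have e3 : Coalgebra.comul (R := k) (adSeq y y' q p (n + 1)) =
        Coalgebra.comul (R := k) y * Coalgebra.comul (R := k) (adSeq y y' q p n) -
        (q ^ n * p) • (Coalgebra.comul (R := k) (adSeq y y' q p n) * Coalgebra.comul (R := k) y) := by
      rw [adSeq_succ, map_sub, map_smul, Bialgebra.comul_mul, Bialgebra.comul_mul]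
    have e4 : ∀ m ∈ Finset.range (n + 1), Coalgebra.comul (R := k) y * (adCoeff q (p * p') n m •
          ((y ^ (n - m) * (g ^ m * h)) ⊗ₜ[k] adSeq y y' q p m)) -
        (q ^ n * p) • (adCoeff q (p * p') n m •
          ((y ^ (n - m) * (g ^ m * h)) ⊗ₜ[k] adSeq y y' q p m) * Coalgebra.comul (R := k) y) =
        ((1 - q ^ (n + m) * (p * p')) * adCoeff q (p * p') n m) •
          ((y ^ (n + 1 - m) * (g ^ m * h)) ⊗ₜ[k] adSeq y y' q p m) +
        (q ^ (n - m) * adCoeff q (p * p') n m) •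
          ((y ^ (n + 1 - (m + 1)) * (g ^ (m + 1) * h)) ⊗ₜ[k] adSeq y y' q p (m + 1)) := by
      intro m hm
      rw [mul_smul_comm, smul_mul_assoc, smul_comm (q ^ n * p), ← smul_sub,
        e2 m (Nat.lt_succ_iff.1 (Finset.mem_range.1 hm)), smul_add, smul_smul, smul_smul,
        mul_comm (adCoeff _ _ _ _), mul_comm (adCoeff _ _ _ _), Nat.add_sub_add_right]
    rw [e3, ih, mul_add, add_mul, smul_add, add_sub_add_comm, e1, Finset.mul_sum, Finset.sum_mul,
      Finset.smul_sum, ← Finset.sum_sub_distrib, Finset.sum_congr rfl e4, Finset.sum_add_distrib]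
    congr 1
    have e5 : ∑ m ∈ Finset.range (n + 1), ((1 - q ^ (n + m) * (p * p')) * adCoeff q (p * p') n m) •
          ((y ^ (n + 1 - m) * (g ^ m * h)) ⊗ₜ[k] adSeq y y' q p m) =
        ∑ m ∈ Finset.range (n + 2), ((1 - q ^ (n + m) * (p * p')) * adCoeff q (p * p') n m) •
          ((y ^ (n + 1 - m) * (g ^ m * h)) ⊗ₜ[k] adSeq y y' q p m) := by
      rw [Finset.sum_range_succ _ (n + 1), adCoeff_eq_zero q _ (Nat.lt_succ_self n), mul_zero,
        zero_smul, add_zero]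
    rw [e5, Finset.sum_range_succ' _ (n + 1), Finset.sum_range_succ' _ (n + 1), add_right_comm,
      ← Finset.sum_add_distrib]
    congr 1
    · refine Finset.sum_congr rfl fun m hm => ?_
      rw [← add_smul, adCoeff_succ_succ q _ (Nat.lt_succ_iff.1 (Finset.mem_range.1 hm))]
    · rw [adCoeff_succ_zero, Nat.add_zero]

/-- If `qⁿ p p' = 1`, then `(ad y)ⁿ⁺¹(y')` is skew primitive. -/
theorem isSkewPrimitive_adSeq (hy : IsSkewPrimitive k g 1 y) (hy' : IsSkewPrimitive k h 1 y')
    (hgh : g * h = h * g) (hgy : g * y = q • (y * g)) (hgy' : g * y' = p • (y' * g))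
    (hhy : h * y = p' • (y * h)) {n : ℕ} (hn : q ^ n * (p * p') = 1) :
    IsSkewPrimitive k (g ^ (n + 1) * h) 1 (adSeq y y' q p (n + 1)) := by
  rw [IsSkewPrimitive, comul_adSeq hy hy' hgh hgy hgy' hhy, Finset.sum_range_succ,
    Finset.sum_eq_zero, zero_add, adCoeff_self, one_smul, Nat.sub_self, pow_zero, one_mul]
  intro m hm
  rw [adCoeff_succ_eq_zero hn (Nat.lt_succ_iff.1 (Finset.mem_range.1 hm)), zero_smul]

end Adjoint

/-! ### Commutation relations of the lifted generators -/

section Lifting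

variable {k Γ A : Type*} [Field k] [CommGroup Γ] [Ring A] [HopfAlgebra k A]

theorem groupLike_mul_eq_smul (e : Γ ≃* GroupLike k A) {ψ : Γ →* kˣ} {z : A}
    (hψ : ∀ h, (e h : A) * z * (e h⁻¹ : A) = (ψ h : k) • z) (h : Γ) :
    (e h : A) * z = (ψ h : k) • (z * e h) := by
  have h1 : (e h⁻¹ : A) * (e h : A) = 1 := by
    rw [← GroupLike.val_mul, ← map_mul, inv_mul_cancel, map_one, GroupLike.val_one]
  rw [← smul_mul_assoc, ← hψ h, mul_assoc, h1, mul_one]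

theorem groupLike_conj_eq_smul (e : Γ ≃* GroupLike k A) {c : k} {z : A} {h : Γ}
    (hz : (e h : A) * z = c • (z * e h)) : (e h : A) * z * (e h⁻¹ : A) = c • z := by
  have h1 : (e h : A) * (e h⁻¹ : A) = 1 := by
    rw [← GroupLike.val_mul, ← map_mul, mul_inv_cancel, map_one, GroupLike.val_one]
  rw [hz, smul_mul_assoc, mul_assoc, h1, mul_one]

/-- If `qᵢⁿ χⱼ(gᵢ) χᵢ(gⱼ) = 1`, then `(ad yᵢ)ⁿ⁺¹(yⱼ)` is a skew-primitive element on which the group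
acts by a character. The Cartan condition gives this for `n = -aᵢⱼ`. -/
theorem isSkewPrimitive_ad_pow {ι : Type*} {g : ι → Γ} {χ : ι → Γ →* kˣ} (e : Γ ≃* GroupLike k A)
    (y : ι → A) (hskew : ∀ i, IsSkewPrimitive k (e (g i) : A) 1 (y i))
    (hchar : ∀ i h, (e h : A) * y i * (e h⁻¹ : A) = (χ i h : k) • y i) {i j : ι} {n : ℕ}
    (hn : χ i (g i) ^ n * (χ j (g i) * χ i (g j)) = 1) :
    IsSkewPrimitive k (e (g i ^ (n + 1) * g j) : A) 1 ((ad k (y i) ^ (n + 1)) (y j)) ∧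
      ∀ h, (e h : A) * (ad k (y i) ^ (n + 1)) (y j) * (e h⁻¹ : A) =
        ((χ i ^ (n + 1) * χ j) h : k) • (ad k (y i) ^ (n + 1)) (y j) := by
  have hc := fun i h => groupLike_mul_eq_smul e (hchar i) h
  rw [ad_pow_eq_adSeq (e (g i)).2 (hskew i) (hc i (g i)) (hc j (g i))]
  constructor
  · have := isSkewPrimitive_adSeq (hskew i) (hskew j)
      (by rw [← GroupLike.val_mul, ← GroupLike.val_mul, ← map_mul, ← map_mul, mul_comm])
      (hc i (g i)) (hc j (g i)) (hc i (g j)) (n := n) (by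
        have h := congrArg Units.val hn
        push_cast at h
        exact h)
    rwa [map_mul, map_pow, GroupLike.val_mul, GroupLike.val_pow]
  · intro h
    refine groupLike_conj_eq_smul e ?_
    rw [mul_adSeq (hc i h) (hc j h)]
    simp

end Lifting

end PointedHopf

end

theorem mainTheorem7
    {k : Type*} [Field k] [IsAlgClosed k] [CharZero k]
    {Γ : Type*} [CommGroup Γ] [Finite Γ]
    -- the datum: a finite Cartan matrix, elements and characters of the group
    {θ : ℕ} (a : Matrix (Fin θ) (Fin θ) ℤ) (ha : PointedHopf.IsFiniteCartanMatrix a)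
    (g : Fin θ → Γ) (χ : Fin θ → Γ →* kˣ)
    (hχ : ∀ i, χ i (g i) ≠ 1)
    (hcartan : ∀ i j, χ j (g i) * χ i (g j) = χ i (g i) ^ a i j)
    (hodd : ∀ i j, Odd (orderOf (χ i (g j))))
    (hthree : ∀ I : (PointedHopf.dynkinGraph a).ConnectedComponent,
      PointedHopf.IsOfType a I.supp CartanMatrix.G₂ →
        ∀ i ∈ I.supp, ¬ 3 ∣ orderOf (χ i (g i)))
    -- the Yetter-Drinfeld module with its homogeneous basis
    {V : Type*} [AddCommGroup V] [Module k V] (Y : PointedHopf.YetterDrinfeld k Γ V)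
    (x : Module.Basis (Fin θ) k V) (hx : ∀ i, Y.IsHomogeneous (g i) (χ i) (x i))
    -- the pointed Hopf algebra, and the isomorphism from `V` to the primitives of its diagram
    {A : Type*} [Ring A] [HopfAlgebra k A] [PointedHopf.IsPointed k A]
    (e : Γ ≃* GroupLike k A)
    (φ : V ≃ₗ[k] PointedHopf.diagramPrimitives k A)
    (hφ : PointedHopf.IsYetterDrinfeldIso e Y φ)
    -- the skew-primitive elements lifting the basis
    (y : Fin θ → A)
    (hskew : ∀ i, PointedHopf.IsSkewPrimitive k (e (g i) : A) 1 (y i))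
    (hchar : ∀ i h, (e h : A) * y i * (e h⁻¹ : A) = (χ i h : k) • y i)
    (hlift : ∀ i, ∃ hy : y i ∈ PointedHopf.coradicalFiltration k A 1,
      PointedHopf.grMk k A 1 ⟨y i, hy⟩ = φ (x i)) :
    (∃ l : Fin θ → Fin θ → k, PointedHopf.IsLinkingDatum a g χ l ∧
      ∀ i j, i < j → ¬ (PointedHopf.dynkinGraph a).Reachable i j →
        y i * y j - (χ j (g i) : k) • (y j * y i) = l i j • (1 - (e (g i * g j) : A))) ∧
    (∀ I : (PointedHopf.dynkinGraph a).ConnectedComponent,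
      (∀ i ∈ I.supp, orderOf (χ i (g i)) ≠ 3) →
      (PointedHopf.IsOfTypeBCF a I.supp → ∀ i ∈ I.supp, orderOf (χ i (g i)) ≠ 5) →
      (PointedHopf.IsOfType a I.supp CartanMatrix.G₂ →
        ∀ i ∈ I.supp, orderOf (χ i (g i)) ≠ 7) →
      ∀ i ∈ I.supp, ∀ j ∈ I.supp, i ≠ j →
        ((PointedHopf.ad k (y i)) ^ (1 - a i j).toNat) (y j) = 0) := by
  open PointedHopf in
  have hodd' : ∀ i, Odd (orderOf (χ i (g i))) := fun i => hodd i i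
  constructor
  · have hlink : ∀ i j, ¬ (dynkinGraph a).Reachable i j → ∃ c : k,
        (¬ Linkable a g χ i j → c = 0) ∧
          y i * y j - (χ j (g i) : k) • (y j * y i) = c • (1 - (e (g i * g j) : A)) := by
      intro i j hij
      have h0 : a i j = 0 := by
        by_contra h0
        refine hij (SimpleGraph.Adj.reachable (ha.adj_iff.2 ⟨?_, h0⟩))
        rintro rfl
        exact hij (.refl _)
      obtain ⟨h1, h2⟩ := isSkewPrimitive_ad_pow e y hskew hchar (i := i) (j := j) (n := 0)
        (by rw [pow_zero, one_mul, hcartan, h0, zpow_zero])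
      have h3 : (ad k (y i) ^ (0 + 1)) (y j) = y i * y j - (χ j (g i) : k) • (y j * y i) := by
        rw [ad_pow_eq_adSeq (e (g i)).2 (hskew i) (groupLike_mul_eq_smul e (hchar i) (g i))
          (groupLike_mul_eq_smul e (hchar j) (g i)), adSeq_succ, pow_zero, one_mul]
        rfl
      rw [h3] at h1 h2
      simp only [zero_add, pow_one] at h1 h2
      have hp : χ i ^ 1 = χ i := pow_one (χ i)
      obtain ⟨⟨c, hc⟩, hz⟩ := h1.exists_eq_smul_of_degree Y x hx e φ hφ h2
        fun l hg hl => not_degree_of_not_reachable ha hχ hcartan hodd' hij l hg (hl.trans (by rw [hp]))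
      by_cases hL : Linkable a g χ i j
      · exact ⟨c, fun h => absurd hL h, hc⟩
      · refine ⟨0, fun _ => rfl, ?_⟩
        rw [zero_smul]
        by_cases hψ : χ i * χ j = 1
        · have hg : g i * g j = 1 := by
            by_contra hg
            exact hL ⟨hij, hg, hψ⟩
          rw [hc, hg, map_one, GroupLike.val_one, sub_self, smul_zero]
        · exact hz (by rwa [hp])
    choose! c hc using hlink
    exact ⟨c, fun i j _ hij hL => (hc i j hij).1 hL, fun i j _ hij => (hc i j hij).2⟩
  · intro I h3 h5 h7 i hi j hj hij
    obtain rfl : (dynkinGraph a).connectedComponentMk i = I := hi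
    obtain ⟨n, hn⟩ : ∃ n : ℕ, a i j = -(n : ℤ) :=
      ⟨(-(a i j)).toNat, by have := ha.nonpos i j hij; omega⟩
    have hN : (1 - a i j).toNat = n + 1 := by omega
    obtain ⟨h1, h2⟩ := isSkewPrimitive_ad_pow e y hskew hchar (i := i) (j := j) (n := n)
      (by rw [hcartan, hn, zpow_neg, zpow_natCast, mul_inv_cancel])
    rw [hN]
    refine (h1.exists_eq_smul_of_degree Y x hx e φ hφ h2 fun l hg hl => ?_).2 ?_
    · rw [← hN] at hg hl
      exact not_degree_of_reachable ha hχ hcartan hodd' hij hj (h3 i rfl) (fun h => h5 h i rfl) l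
        hg hl
    · rw [← hN]
      exact character_ne_one_of_reachable ha hχ hcartan hodd' hij hj h3 (fun h => h5 h i rfl)
        fun h => h7 h i rfl
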